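/- Let $d\ge 2$. For nonnegative $\psi$ on $\mathbb R^d$ put $$\mathcal Q^-(\psi,\psi)(\xi)=\psi(\xi)\int_{\mathbb R^d}|\xi-\xi_*|\,\psi(\xi_*)\,d\xi_*,\qquad \mathcal Q^+(\psi,\psi)(\xi)=\frac1{|\mathbb S^{d-1}|}\int_{\mathbb R^d\times\mathbb S^{d-1}}|\xi-\xi_*|\,\psi(\xi')\,\psi(\xi'_*)\,d\xi_*\,d\sigma,$$ where $\xi'=\frac{\xi+\xi_*}2+\frac{|\xi-\xi_*|}2\sigma$ and $\xi'_*=\frac{\xi+\xi_*}2-\frac{|\xi-\xi_*|}2\sigma$. For $\alpha\in(0,1)$ put $\mathbb B_\alpha(\psi,\psi)=(1-\alpha)\mathcal Q^+(\psi,\psi)-\mathcal Q^-(\psi,\psi)$ and $$\mathbf A_\psi=-\frac\alpha2\int_{\mathbb R^d}(d+2-2|\xi|^2)\,\mathcal Q^-(\psi,\psi)(\xi)\,d\xi,\qquad \mathbf B_\psi=-\frac\alpha{2d}\int_{\mathbb R^d}(d-2|\xi|^2)\,\mathcal Q^-(\psi,\psi)(\xi)\,d\xi .$$ Let $\mathscr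 E_\alpha$ be the set of all nonnegative measurable $\psi$ with $\int\psi\,(1+|\xi|^2)\,d\xi<\infty$ and $$\int_{\mathbb R^d}\psi\,d\xi=1,\qquad \int_{\mathbb R^d}\psi\,\xi\,d\xi=0,\qquad \int_{\mathbb R^d}\psi\,|\xi|^2\,d\xi=\frac d2,$$ for which the integrals defining $\mathbf A_\psi,\mathbf B_\psi$ converge absolutely and $$\mathbf A_\psi\,\psi+\mathbf B_\psi\,\xi\cdot\nabla_\xi\psi=\mathbb B_\alpha(\psi,\psi)\quad\text{in the sense of distributions on }\mathbb R^d .$$ Finally let $$\alpha_0=\frac{1-\varrho_{3/2}}{\frac32-\varrho_{3/2}},\qquad \varrho_{k}=\frac1{|\mathbb S^{d-1}|}\int_{\mathbb S^{d-1}}\left[\Big(\frac{1+U\cdot\sigma}2\Big)^{k}+\Big(\frac{1-U\cdot\sigma}2\Big)^{k}\right]d\sigma,$$ where $U$ is any unit vector ($\varrho_k$ does not depend on it). **Proposition 2.4.** Let $\alpha_\star<\alpha_0$. There exist constants $A>0$ and $M>0$ (depending only on $d$ and $\alpha_\star$) such that for every $\alpha\in(0,\alpha_\star]$ and every $\psi_\alpha\in\mathscr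 E_\alpha$, $$\int_{\mathbb R^d}\psi_\alpha(\xi)\,e^{A|\xi|}\,d\xi\le M .$$ In particular this holds for every $\alpha_\star<\underline\alpha_1$, whenever $\underline\alpha_1\le\alpha_0$ is a threshold below which such profiles are known to exist. -/

import Mathlib

open MeasureTheory
open scoped ContDiff

namespace Annihilation

noncomputable section

/-- The velocity space `ℝ^d` with its Euclidean norm. -/
abbrev Vel (d : ℕ) : Type := EuclideanSpace ℝ (Fin d)

/-- The unit sphere of `ℝ^d`. -/
abbrev Sph (d : ℕ) : Type := Metric.sphere (0 : Vel d) 1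

/-- The normalized surface measure `dσ / |S^{d-1}|` on the unit sphere. -/
def sphereMeasure (d : ℕ) : Measure (Sph d) :=
  ((volume : Measure (Vel d)).toSphere Set.univ)⁻¹ • (volume : Measure (Vel d)).toSphere

/-- The post-collisional velocity `v' = (v + v_*)/2 + (|v - v_*|/2) σ`. -/
def post {d : ℕ} (v w : Vel d) (σ : Sph d) : Vel d :=
  (1 / 2 : ℝ) • (v + w) + (‖v - w‖ / 2) • (σ : Vel d)

/-- The post-collisional velocity `v'_* = (v + v_*)/2 - (|v - v_*|/2) σ`. -/
def postStar {d : ℕ} (v w : Vel d) (σ : Sph d) : Vel d :=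
  (1 / 2 : ℝ) • (v + w) - (‖v - w‖ / 2) • (σ : Vel d)

/-- Gain operator
`Q⁺(g,f)(v) = |S^{d-1}|⁻¹ ∫_{ℝ^d × S^{d-1}} |v - v_*| g(v') f(v'_*) dv_* dσ`. -/
def gain {d : ℕ} (g f : Vel d → ℝ) (v : Vel d) : ℝ :=
  ∫ p : Vel d × Sph d, ‖v - p.1‖ * (g (post v p.1 p.2) * f (postStar v p.1 p.2))
    ∂((volume : Measure (Vel d)).prod (sphereMeasure d))

/-- Loss operator `Q⁻(g,f)(v) = g(v) ∫_{ℝ^d} |v - v_*| f(v_*) dv_*`. -/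
def loss {d : ℕ} (g f : Vel d → ℝ) (v : Vel d) : ℝ :=
  g v * ∫ w : Vel d, ‖v - w‖ * f w

/-- The hard-sphere Boltzmann operator `Q = Q⁺ - Q⁻`. -/
def boltzmann {d : ℕ} (g f : Vel d → ℝ) (v : Vel d) : ℝ :=
  gain g f v - loss g f v

/-- The annihilation operator `𝔹_α(f,f) = (1-α) Q(f,f) - α Q⁻(f,f)`. -/
def annihilation {d : ℕ} (α : ℝ) (f : Vel d → ℝ) (v : Vel d) : ℝ :=
  (1 - α) * boltzmann f f v - α * loss f f v

/-- The coefficient `A_ψ = -(α/2) ∫ (d + 2 - 2|ξ|²) Q⁻(ψ,ψ)(ξ) dξ`. -/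
def coeffA {d : ℕ} (α : ℝ) (ψ : Vel d → ℝ) : ℝ :=
  -(α / 2) * ∫ ξ : Vel d, ((d : ℝ) + 2 - 2 * ‖ξ‖ ^ 2) * loss ψ ψ ξ

/-- The coefficient `B_ψ = -(α/(2d)) ∫ (d - 2|ξ|²) Q⁻(ψ,ψ)(ξ) dξ`. -/
def coeffB {d : ℕ} (α : ℝ) (ψ : Vel d → ℝ) : ℝ :=
  -(α / (2 * (d : ℝ))) * ∫ ξ : Vel d, ((d : ℝ) - 2 * ‖ξ‖ ^ 2) * loss ψ ψ ξ

/-- `ψ` solves `A_ψ ψ + B_ψ ξ·∇ψ = 𝔹_α(ψ,ψ)` in the sense of distributions on `ℝ^d`. The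
derivative is moved to the test function through `div (ξ φ) = d φ + ξ·∇φ`. -/
def IsWeakSolution {d : ℕ} (α : ℝ) (ψ : Vel d → ℝ) : Prop :=
  ∀ φ : Vel d → ℝ, ContDiff ℝ ∞ φ → HasCompactSupport φ →
    coeffA α ψ * (∫ ξ : Vel d, ψ ξ * φ ξ)
        - coeffB α ψ * (∫ ξ : Vel d, ψ ξ * ((d : ℝ) * φ ξ + fderiv ℝ φ ξ ξ))
      = ∫ ξ : Vel d, annihilation α ψ ξ * φ ξ

/-- The set `ℰ_α` of self-similar profiles: the nonnegative solutions of the stationary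
annihilation equation with unit mass, zero momentum and energy `d/2`. -/
structure IsProfile {d : ℕ} (α : ℝ) (ψ : Vel d → ℝ) : Prop where
  measurable : Measurable ψ
  nonneg : ∀ ξ, 0 ≤ ψ ξ
  /-- `ψ ∈ L¹₂`. -/
  integrable : Integrable (fun ξ : Vel d => ψ ξ * (1 + ‖ξ‖ ^ 2))
  mass : ∫ ξ : Vel d, ψ ξ = 1
  momentum : ∫ ξ : Vel d, ψ ξ • ξ = 0
  energy : ∫ ξ : Vel d, ψ ξ * ‖ξ‖ ^ 2 = (d : ℝ) / 2
  /-- The integrals that define `A_ψ` and `B_ψ` converge (that of `Q⁻(ψ,ψ)` itself always does,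
  since `ψ ∈ L¹₂`). -/
  integrable_coeff : Integrable (fun ξ : Vel d => ‖ξ‖ ^ 2 * loss ψ ψ ξ)
  equation : IsWeakSolution α ψ

/-- `ϱ_k = |S^{d-1}|⁻¹ ∫ [((1 + U·σ)/2)^k + ((1 - U·σ)/2)^k] dσ`, where `U` is a fixed unit vector,
here the first vector of the canonical basis (by rotation invariance its choice is irrelevant). -/
def rho (d : ℕ) [NeZero d] (k : ℝ) : ℝ :=
  ∫ σ : Sph d, (((1 + (σ : Vel d) 0) / 2) ^ k + ((1 - (σ : Vel d) 0) / 2) ^ k) ∂(sphereMeasure d)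

/-- The threshold `α₀ = (1 - ϱ_{3/2}) / (3/2 - ϱ_{3/2})`; it equals `2/7` for `d = 3`. -/
def alphaZero (d : ℕ) [NeZero d] : ℝ :=
  (1 - rho d (3 / 2)) / (3 / 2 - rho d (3 / 2))

end

end Annihilation

/-! Write m_j for the moment of order j of the law μ = ψ dξ, and a = ∫ Q⁻, b = ∫ |ξ|² Q⁻. Testing
the equation with φ relates the loss and gain integrals L and G of φ by L = (1-α) G + α a ∫ φ dμ + B
∫ ξ·∇φ dμ, where B = α b/d - α a/2. For φ = |ξ|^m with m ≥ 2 the terms in a add up to something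
nonpositive, and only α (m/d) b m_m remains.

Two facts turn this into a moment bound. Since μ is centred, Jensen bounds the collision frequency
below by |ξ|, so L ≥ m_{m+1} (`integral_norm_mul_le`). Since the angular average spreads energy
between the two particles, Povzner's inequality (`povzner`) bounds the average of |ξ'|^m + |ξ'_*|^m
by ρ (|ξ|² + |ξ_*|²)^{m/2}, with the same ρ = ϱ_{3/2} ≤ 1 for all m ≥ 3. Hence G ≤ ρ (L + S) with S
a sum of products of moments of order below m+1, and (1 - (1-α)ρ) m_{m+1} ≤ S + α (m/d) b m_m
(`WeakIdentity.power_bound`).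

The threshold appears at m = 3. There b ≤ m_3 + (d/2) m_1 makes the drift quadratic in m_3, and
Cauchy-Schwarz, m_3² ≤ (d/2) m_4, charges it to m_4 at cost 3α/2. What is left in front of m_4 is 1
- ρ - α(3/2 - ρ), positive exactly when α < α₀. This bounds m_3, hence b, uniformly in α
(`IsProfileLaw.third_moment_le`). For even m the inequality is then a recursion with uniform
constants; it gives m_n ≤ C K^n n! (`factorial_bound`), and the exponential series is summed
(`exponential_moment`).

All of this needs finite moments, while a profile only comes with three.
`IsProfileLaw.truncated_moment_le` supplies them by testing with truncated powers. That step absorbs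
terms by means of α > 0, so its bounds degenerate as α → 0, and only finiteness is kept. -/

namespace Annihilation

/-! ### Collision geometry and rotation invariance of the sphere measure -/

section Geometry

variable {d : ℕ}

instance isProbabilityMeasure_sphereMeasure [NeZero d] :
    IsProbabilityMeasure (sphereMeasure d) := by
  refine ⟨?_⟩
  have h : (volume : Measure (Vel d)).toSphere ≠ 0 := Measure.toSphere_ne_zero _
  rw [sphereMeasure, Measure.smul_apply, smul_eq_mul]
  exact ENNReal.inv_mul_cancel (Measure.measure_univ_ne_zero.2 h) (measure_ne_top _ _)

instance sFinite_sphereMeasure : SFinite (sphereMeasure d) := by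
  unfold sphereMeasure
  infer_instance

/-- The action of a linear isometry on the unit sphere. -/
noncomputable def sphereMap (Φ : Vel d ≃ₗᵢ[ℝ] Vel d) (σ : Sph d) : Sph d :=
  ⟨Φ σ, by simp⟩

theorem measurable_sphereMap (Φ : Vel d ≃ₗᵢ[ℝ] Vel d) : Measurable (sphereMap Φ) := by
  refine (Continuous.subtype_mk ?_ _).measurable
  exact Φ.continuous.comp continuous_subtype_val

open scoped Pointwise in
-- The surface measure of a set is, up to a factor, the volume of the cone over it, and a linear
-- isometry commutes with taking cones.
theorem measurePreserving_sphereMap (Φ : Vel d ≃ₗᵢ[ℝ] Vel d) :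
    MeasurePreserving (sphereMap Φ) (sphereMeasure d) (sphereMeasure d) := by
  suffices h : MeasurePreserving (sphereMap Φ) (volume : Measure (Vel d)).toSphere
      (volume : Measure (Vel d)).toSphere by
    refine ⟨h.measurable, ?_⟩
    rw [sphereMeasure, Measure.map_smul, h.map_eq]
  refine ⟨measurable_sphereMap Φ, ?_⟩
  ext s hs
  rw [Measure.map_apply (measurable_sphereMap Φ) hs, Measure.toSphere_apply' _ hs,
    Measure.toSphere_apply' _ (measurable_sphereMap Φ hs)]
  congr 1
  have himage : (Set.Ioo (0 : ℝ) 1 • ((↑) '' (sphereMap Φ ⁻¹' s) : Set (Vel d)))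
      = Φ ⁻¹' (Set.Ioo (0 : ℝ) 1 • ((↑) '' s : Set (Vel d))) := by
    ext x
    simp only [Set.mem_smul, Set.mem_image, Set.mem_preimage]
    constructor
    · rintro ⟨r, hr, y, ⟨σ, hσ, rfl⟩, rfl⟩
      exact ⟨r, hr, _, ⟨_, hσ, rfl⟩, by simp [sphereMap]⟩
    · rintro ⟨r, hr, y, ⟨σ, hσ, rfl⟩, h⟩
      refine ⟨r, hr, Φ.symm σ, ⟨sphereMap Φ.symm σ, ?_, rfl⟩, ?_⟩
      · simpa [sphereMap] using hσ
      · apply Φ.injective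
        simp [h]
  rw [himage]
  exact Φ.measurePreserving.measure_preimage_equiv (f := Φ.toHomeomorph.toMeasurableEquiv) _

theorem integral_sphereMap (Φ : Vel d ≃ₗᵢ[ℝ] Vel d) (f : Sph d → ℝ) (hf : Measurable f) :
    ∫ σ, f (sphereMap Φ σ) ∂(sphereMeasure d) = ∫ σ, f σ ∂(sphereMeasure d) := by
  have h := measurePreserving_sphereMap Φ
  conv_rhs => rw [← h.map_eq]
  rw [integral_map h.measurable.aemeasurable hf.aestronglyMeasurable]

/-- The sphere average of a function of one coordinate does not depend on the axis. -/
theorem integral_inner_sphere [NeZero d] (e : Vel d) (he : ‖e‖ = 1) (g : ℝ → ℝ)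
    (hg : Measurable g) :
    ∫ σ : Sph d, g (inner ℝ e (σ : Vel d)) ∂(sphereMeasure d)
      = ∫ σ : Sph d, g ((σ : Vel d) 0) ∂(sphereMeasure d) := by
  set e₀ : Vel d := EuclideanSpace.single 0 1
  have he₀ : ‖e₀‖ = 1 := by simp [e₀]
  -- The reflection in the hyperplane orthogonal to e - e₀ carries the unit vector e to e₀.
  obtain ⟨Φ, hΦ⟩ : ∃ Φ : Vel d ≃ₗᵢ[ℝ] Vel d, Φ e = e₀ :=
    ⟨(Submodule.span ℝ {e - e₀})ᗮ.reflection, Submodule.reflection_sub (he.trans he₀.symm)⟩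
  rw [← integral_sphereMap Φ (fun σ : Sph d => g ((σ : Vel d) 0))]
  · refine integral_congr_ae (Filter.Eventually.of_forall fun σ => ?_)
    have : inner ℝ e (σ : Vel d) = (Φ (σ : Vel d)) 0 := by
      rw [← Φ.inner_map_map, hΦ]
      simp [e₀, EuclideanSpace.inner_single_left]
    simp [this, sphereMap]
  · refine hg.comp ?_
    exact (by fun_prop : Continuous fun σ : Sph d => (σ : Vel d) 0).measurable

theorem norm_post_sq (v w : Vel d) (σ : Sph d) :
    ‖post v w σ‖ ^ 2 = (‖v‖ ^ 2 + ‖w‖ ^ 2) / 2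
      + ‖v - w‖ / 2 * inner ℝ (v + w) (σ : Vel d) := by
  have hσ : ‖(σ : Vel d)‖ = 1 := by simp
  have h1 := parallelogram_law_with_norm ℝ v w
  rw [post, norm_add_sq_real, norm_smul, norm_smul, inner_smul_left, inner_smul_right, hσ]
  simp only [Real.norm_eq_abs, mul_pow, sq_abs, conj_trivial]
  nlinarith

theorem norm_postStar_sq (v w : Vel d) (σ : Sph d) :
    ‖postStar v w σ‖ ^ 2 = (‖v‖ ^ 2 + ‖w‖ ^ 2) / 2
      - ‖v - w‖ / 2 * inner ℝ (v + w) (σ : Vel d) := by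
  have hσ : ‖(σ : Vel d)‖ = 1 := by simp
  have h1 := parallelogram_law_with_norm ℝ v w
  rw [postStar, norm_sub_sq_real, norm_smul, norm_smul, inner_smul_left, inner_smul_right, hσ]
  simp only [Real.norm_eq_abs, mul_pow, sq_abs, conj_trivial]
  nlinarith

theorem norm_post_sq_add_norm_postStar_sq (v w : Vel d) (σ : Sph d) :
    ‖post v w σ‖ ^ 2 + ‖postStar v w σ‖ ^ 2 = ‖v‖ ^ 2 + ‖w‖ ^ 2 := by
  rw [norm_post_sq, norm_postStar_sq]; ring

theorem norm_post_sub_postStar (v w : Vel d) (σ : Sph d) :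
    ‖post v w σ - postStar v w σ‖ = ‖v - w‖ := by
  have hσ : ‖(σ : Vel d)‖ = 1 := by simp
  have : post v w σ - postStar v w σ = ‖v - w‖ • (σ : Vel d) := by
    simp only [post, postStar]; module
  rw [this, norm_smul, hσ, mul_one, norm_norm]

theorem norm_post_le (v w : Vel d) (σ : Sph d) : ‖post v w σ‖ ≤ ‖v‖ + ‖w‖ := by
  have h := norm_post_sq_add_norm_postStar_sq v w σ
  refine le_of_sq_le_sq ?_ (by positivity)
  nlinarith [sq_nonneg ‖postStar v w σ‖, norm_nonneg v, norm_nonneg w,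
    mul_nonneg (norm_nonneg v) (norm_nonneg w)]

theorem continuous_post : Continuous fun p : Vel d × Vel d × Sph d => post p.1 p.2.1 p.2.2 := by
  unfold post; fun_prop

theorem continuous_postStar :
    Continuous fun p : Vel d × Vel d × Sph d => postStar p.1 p.2.1 p.2.2 := by
  unfold postStar; fun_prop

end Geometry

/-! ### Angular averages of post-collisional energies -/

section Povzner

variable {d : ℕ}

/-- Among splittings of the energy `1` the power sum is largest for the most unequal one. -/
theorem rpow_split_le {k s t : ℝ} (hk : 3 / 2 ≤ k) (ht : |s - 1 / 2| ≤ |t - 1 / 2|)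
    (ht1 : |t - 1 / 2| ≤ 1 / 2) :
    s ^ k + (1 - s) ^ k ≤ t ^ (3 / 2 : ℝ) + (1 - t) ^ (3 / 2 : ℝ) := by
  obtain ⟨t0, t1⟩ := abs_le.1 ht1
  obtain ⟨s0, s1⟩ := abs_le.1 (ht.trans ht1)
  have hpow : ∀ u : ℝ, 0 ≤ u → u ≤ 1 → u ^ k ≤ u ^ (3 / 2 : ℝ) := fun u h0 h1 =>
    Real.rpow_le_rpow_of_exponent_ge' h0 h1 (by norm_num) hk
  refine (add_le_add (hpow s (by linarith) (by linarith))
    (hpow (1 - s) (by linarith) (by linarith))).trans ?_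
  have hconv := convexOn_rpow (p := 3 / 2) (by norm_num)
  -- s lies between t and 1 - t, hence is a convex combination of them, and 1 - s is the mirrored
  -- one; convexity of x^{3/2} applied to both and summed gives the bound.
  obtain ⟨l, l0, l1, hl⟩ : ∃ l : ℝ, 0 ≤ l ∧ l ≤ 1 ∧ s = l * t + (1 - l) * (1 - t) := by
    by_cases h : t - 1 / 2 = 0
    · have hs : s - 1 / 2 = 0 := by
        rw [h, abs_zero] at ht
        exact abs_eq_zero.1 (le_antisymm ht (abs_nonneg _))
      exact ⟨0, le_rfl, zero_le_one, by linarith⟩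
    · have hq : |(s - 1 / 2) / (t - 1 / 2)| ≤ 1 := by
        rw [abs_div]
        exact div_le_one_of_le₀ ht (abs_nonneg _)
      obtain ⟨q0, q1⟩ := abs_le.1 hq
      refine ⟨(1 + (s - 1 / 2) / (t - 1 / 2)) / 2, by linarith, by linarith, ?_⟩
      linear_combination -(div_mul_cancel₀ (s - 1 / 2) h)
  have h1 := hconv.2 (x := t) (y := 1 - t) (by simp; linarith) (by simp; linarith) l0
    (sub_nonneg.2 l1) (by ring)
  have h2 := hconv.2 (x := 1 - t) (y := t) (by simp; linarith) (by simp; linarith) l0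
    (sub_nonneg.2 l1) (by ring)
  simp only [smul_eq_mul] at h1 h2
  have e2 : 1 - s = l * (1 - t) + (1 - l) * t := by rw [hl]; ring
  rw [e2, hl]
  linarith

theorem abs_coord_sphere_le [NeZero d] (σ : Sph d) : |(σ : Vel d) 0| ≤ 1 := by
  have := PiLp.norm_apply_le (σ : Vel d) 0
  simpa using this

theorem continuous_rho_integrand [NeZero d] : Continuous fun σ : Sph d =>
    (((1 + (σ : Vel d) 0) / 2) ^ (3 / 2 : ℝ) + ((1 - (σ : Vel d) 0) / 2) ^ (3 / 2 : ℝ)) := by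
  refine Continuous.add ?_ ?_
  · exact Continuous.rpow_const (by fun_prop) fun _ => Or.inr (by norm_num)
  · exact Continuous.rpow_const (by fun_prop) fun _ => Or.inr (by norm_num)

/-- The two fractions lie in [0,1] and add up to 1, and u^{3/2} ≤ u there. Strict inequality is
never needed separately: it is contained in the condition on κ below. -/
theorem rho_three_halves_le_one [NeZero d] : rho d (3 / 2) ≤ 1 := by
  have hint : Integrable (fun σ : Sph d => (((1 + (σ : Vel d) 0) / 2) ^ (3 / 2 : ℝ)
      + ((1 - (σ : Vel d) 0) / 2) ^ (3 / 2 : ℝ))) (sphereMeasure d) :=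
    continuous_rho_integrand.integrable_of_hasCompactSupport (HasCompactSupport.of_compactSpace _)
  calc rho d (3 / 2) ≤ ∫ _ : Sph d, (1 : ℝ) ∂(sphereMeasure d) := by
        refine integral_mono hint (integrable_const _) fun σ => ?_
        obtain ⟨h0, h1⟩ := abs_le.1 (abs_coord_sphere_le σ)
        have hpow : ∀ u : ℝ, 0 ≤ u → u ≤ 1 → u ^ (3 / 2 : ℝ) ≤ u := fun u h0 h1 => by
          simpa using Real.rpow_le_rpow_of_exponent_ge' h0 h1 zero_le_one
            (by norm_num : (1 : ℝ) ≤ 3 / 2)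
        have ha := hpow ((1 + (σ : Vel d) 0) / 2) (by linarith) (by linarith)
        have hb := hpow ((1 - (σ : Vel d) 0) / 2) (by linarith) (by linarith)
        dsimp only
        linarith
    _ = 1 := by simp

theorem rho_nonneg [NeZero d] : 0 ≤ rho d (3 / 2) := by
  refine integral_nonneg fun σ => ?_
  obtain ⟨h0, h1⟩ := abs_le.1 (abs_coord_sphere_le σ)
  exact add_nonneg (Real.rpow_nonneg (by linarith) _) (Real.rpow_nonneg (by linarith) _)

/-- Povzner's inequality: the sphere average of the post-collisional moments. -/
theorem povzner [NeZero d] {k : ℝ} (hk : 3 / 2 ≤ k) (v w : Vel d) :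
    ∫ σ : Sph d, ((‖post v w σ‖ ^ 2) ^ k + (‖postStar v w σ‖ ^ 2) ^ k) ∂(sphereMeasure d)
      ≤ rho d (3 / 2) * (‖v‖ ^ 2 + ‖w‖ ^ 2) ^ k := by
  set E := ‖v‖ ^ 2 + ‖w‖ ^ 2 with hE
  have hE0 : 0 ≤ E := by positivity
  obtain ⟨e, he, hve⟩ : ∃ e : Vel d, ‖e‖ = 1 ∧ v + w = ‖v + w‖ • e := by
    by_cases h : v + w = 0
    · exact ⟨EuclideanSpace.single 0 1, by simp, by simp [h]⟩
    · refine ⟨‖v + w‖⁻¹ • (v + w), norm_smul_inv_norm (𝕜 := ℝ) h, ?_⟩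
      rw [smul_smul, mul_inv_cancel₀ (norm_ne_zero_iff.2 h), one_smul]
  have hint : Integrable (fun σ : Sph d => (((1 + inner ℝ e (σ : Vel d)) / 2) ^ (3 / 2 : ℝ)
      + ((1 - inner ℝ e (σ : Vel d)) / 2) ^ (3 / 2 : ℝ))) (sphereMeasure d) := by
    refine Continuous.integrable_of_hasCompactSupport ?_ (HasCompactSupport.of_compactSpace _)
    refine Continuous.add ?_ ?_
    · exact Continuous.rpow_const (by fun_prop) fun _ => Or.inr (by norm_num)
    · exact Continuous.rpow_const (by fun_prop) fun _ => Or.inr (by norm_num)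
  have hpt : ∀ σ : Sph d, (‖post v w σ‖ ^ 2) ^ k + (‖postStar v w σ‖ ^ 2) ^ k
      ≤ (((1 + inner ℝ e (σ : Vel d)) / 2) ^ (3 / 2 : ℝ)
      + ((1 - inner ℝ e (σ : Vel d)) / 2) ^ (3 / 2 : ℝ)) * E ^ k := by
    intro σ
    have hσ : ‖(σ : Vel d)‖ = 1 := by simp
    have hτ : |inner ℝ e (σ : Vel d)| ≤ 1 := by
      simpa [he, hσ] using abs_real_inner_le_norm e (σ : Vel d)
    have hsum := norm_post_sq_add_norm_postStar_sq v w σ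
    rw [← hE] at hsum
    rcases hE0.eq_or_lt with h0 | hpos
    · have h1 : ‖post v w σ‖ ^ 2 = 0 := by
        nlinarith [sq_nonneg ‖post v w σ‖, sq_nonneg ‖postStar v w σ‖]
      have h2 : ‖postStar v w σ‖ ^ 2 = 0 := by
        nlinarith [sq_nonneg ‖post v w σ‖, sq_nonneg ‖postStar v w σ‖]
      rw [h1, h2, ← h0, Real.zero_rpow (by linarith)]
      simp
    set s := ‖post v w σ‖ ^ 2 / E with hs
    have e1 : ‖post v w σ‖ ^ 2 = E * s := by rw [hs]; field_simp
    have e2 : ‖postStar v w σ‖ ^ 2 = E * (1 - s) := by rw [mul_sub, ← e1]; linarith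
    have s0 : 0 ≤ s := by positivity
    have s1 : 0 ≤ 1 - s := by
      have : 0 ≤ E * (1 - s) := e2 ▸ sq_nonneg _
      exact nonneg_of_mul_nonneg_right this hpos
    rw [e1, e2, Real.mul_rpow hE0 s0, Real.mul_rpow hE0 s1, ← mul_add, mul_comm]
    refine mul_le_mul_of_nonneg_right ?_ (Real.rpow_nonneg hE0 _)
    -- The energy fraction s deviates from 1/2 by a factor |v-w||v+w|/E times the deviation of (1 +
    -- e·σ)/2. The factor is at most 1 by the parallelogram law and 2xy ≤ x² + y², so the worst pair
    -- has a factor 1, which no longer depends on v and w.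
    have hs2 : s - 1 / 2 = (‖v - w‖ * ‖v + w‖ / E) * (inner ℝ e (σ : Vel d) / 2) := by
      have h3 := norm_post_sq v w σ
      rw [e1, hve, inner_smul_left, ← hE] at h3
      simp only [conj_trivial] at h3
      field_simp
      linarith
    have hμ : |‖v - w‖ * ‖v + w‖ / E| ≤ 1 := by
      rw [abs_of_nonneg (by positivity), div_le_one hpos]
      nlinarith [parallelogram_law_with_norm ℝ v w, sq_nonneg (‖v - w‖ - ‖v + w‖)]
    have key := rpow_split_le (s := s) (t := (1 + inner ℝ e (σ : Vel d)) / 2) hk ?_ ?_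
    · have e3 : 1 - (1 + inner ℝ e (σ : Vel d)) / 2 = (1 - inner ℝ e (σ : Vel d)) / 2 := by ring
      rwa [e3] at key
    · have e4 : (1 + inner ℝ e (σ : Vel d)) / 2 - 1 / 2 = inner ℝ e (σ : Vel d) / 2 := by ring
      rw [hs2, e4, abs_mul]
      exact mul_le_of_le_one_left (abs_nonneg _) hμ
    · have e4 : (1 + inner ℝ e (σ : Vel d)) / 2 - 1 / 2 = inner ℝ e (σ : Vel d) / 2 := by ring
      rw [e4, abs_div, abs_two]
      linarith
  calc _ ≤ ∫ σ : Sph d, (((1 + inner ℝ e (σ : Vel d)) / 2) ^ (3 / 2 : ℝ)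
      + ((1 - inner ℝ e (σ : Vel d)) / 2) ^ (3 / 2 : ℝ)) * E ^ k ∂(sphereMeasure d) := by
        refine integral_mono_of_nonneg (Filter.Eventually.of_forall fun σ => ?_)
          (hint.mul_const _) (Filter.Eventually.of_forall hpt)
        exact add_nonneg (Real.rpow_nonneg (sq_nonneg _) _) (Real.rpow_nonneg (sq_nonneg _) _)
    _ = rho d (3 / 2) * E ^ k := by
        rw [integral_mul_const]
        congr 1
        exact integral_inner_sphere e he
          (fun τ => ((1 + τ) / 2) ^ (3 / 2 : ℝ) + ((1 - τ) / 2) ^ (3 / 2 : ℝ)) (by fun_prop)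

end Povzner

/-! ### The pre-post-collisional change of variables -/

section ChangeOfVariables

variable {d : ℕ}

open scoped ENNReal

theorem lintegral_polar [NeZero d] (f : Vel d → ℝ≥0∞) (hf : Measurable f) :
    ∫⁻ u, f u = ∫⁻ η : Sph d, ∫⁻ r : Set.Ioi (0 : ℝ), f (r.1 • (η : Vel d))
      ∂(Measure.volumeIoiPow (Module.finrank ℝ (Vel d) - 1))
      ∂((volume : Measure (Vel d)).toSphere) := by
  have h := (volume : Measure (Vel d)).measurePreserving_homeomorphUnitSphereProd
  have hmeas : Measurable fun p : Sph d × Set.Ioi (0 : ℝ) => f (p.2.1 • (p.1 : Vel d)) := by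
    refine hf.comp (Continuous.measurable ?_)
    fun_prop
  rw [← lintegral_prod _ hmeas.aemeasurable, ← h.lintegral_comp hmeas]
  rw [← setLIntegral_univ, ← setLIntegral_congr (μ := (volume : Measure (Vel d)))
    (s := ({0}ᶜ : Set (Vel d))), ← lintegral_subtype_comap (measurableSet_singleton _).compl]
  · refine lintegral_congr fun x => ?_
    have := congrArg Subtype.val ((homeomorphUnitSphereProd (Vel d)).symm_apply_apply x)
    rw [homeomorphUnitSphereProd_symm_apply_coe] at this
    rw [this]
  · rw [ae_eq_univ]
    simp

/-- Exchanging the direction of the relative velocity with the collision parameter. -/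
theorem lintegral_sphere_swap [NeZero d] (K : Vel d × Vel d → ℝ≥0∞) (hK : Measurable K) :
    ∫⁻ u : Vel d, ∫⁻ σ : Sph d, K (u, ‖u‖ • (σ : Vel d)) ∂(sphereMeasure d)
      = ∫⁻ u : Vel d, ∫⁻ σ : Sph d, K (‖u‖ • (σ : Vel d), u) ∂(sphereMeasure d) := by
  set τ := (volume : Measure (Vel d)).toSphere with hτ
  set ν := Measure.volumeIoiPow (Module.finrank ℝ (Vel d) - 1) with hν
  have hc1 : Continuous fun p : Vel d × Sph d => ((p.1, ‖p.1‖ • (p.2 : Vel d)) : Vel d × Vel d) := by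
    fun_prop
  have hc2 : Continuous fun p : Vel d × Sph d => ((‖p.1‖ • (p.2 : Vel d), p.1) : Vel d × Vel d) := by
    fun_prop
  have hm1 := hK.comp hc1.measurable
  have hm2 := hK.comp hc2.measurable
  -- In polar coordinates u = rη both sides become integrals over r and an independent pair of
  -- directions; at fixed r the claim is Tonelli for that pair.
  have key : ∀ F : Vel d × Sph d → ℝ≥0∞, Measurable F →
      ∫⁻ u : Vel d, ∫⁻ σ : Sph d, F (u, σ) ∂(sphereMeasure d)
      = (τ Set.univ)⁻¹ * ∫⁻ r, ∫⁻ η, ∫⁻ σ, F (r.1 • (η : Vel d), σ) ∂τ ∂τ ∂ν := by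
    intro F hF
    rw [lintegral_polar _ hF.lintegral_prod_right']
    have h3 : Measurable fun q : (Sph d × Set.Ioi (0 : ℝ)) × Sph d =>
        F (q.1.2.1 • (q.1.1 : Vel d), q.2) := by
      refine hF.comp (Continuous.measurable ?_)
      fun_prop
    simp only [sphereMeasure, lintegral_smul_measure, smul_eq_mul]
    rw [← hτ, ← hν]
    rw [lintegral_lintegral_swap]
    · rw [← lintegral_const_mul]
      · refine lintegral_congr fun r => ?_
        rw [← lintegral_const_mul]
        have h4 : Measurable fun q : Sph d × Sph d => F (r.1 • (q.1 : Vel d), q.2) := by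
          refine hF.comp (Continuous.measurable ?_)
          fun_prop
        exact h4.lintegral_prod_right'
      · have h5 : Measurable fun q : Set.Ioi (0 : ℝ) × Sph d =>
            ∫⁻ σ, F (q.1.1 • (q.2 : Vel d), σ) ∂τ :=
          (h3.comp ((measurable_swap).prodMap measurable_id)).lintegral_prod_right'
        exact h5.lintegral_prod_right'
    · exact (h3.lintegral_prod_right'.const_mul _).aemeasurable
  refine (key _ hm1).trans (Eq.trans ?_ (key _ hm2).symm)
  congr 1
  refine lintegral_congr fun r => ?_
  have hr : ∀ η : Sph d, ‖r.1 • (η : Vel d)‖ = r.1 := fun η => by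
    rw [norm_smul]
    simp [abs_of_pos (show 0 < r.1 from r.2)]
  rw [lintegral_lintegral_swap]
  · simp only [Function.comp_apply, hr]
  · have h6 : Measurable fun q : Sph d × Sph d => (r.1 • (q.1 : Vel d), q.2) :=
      Continuous.measurable (by fun_prop)
    exact (hm1.comp h6).aemeasurable

/-- In the variables u = v - w and c = (v + w)/2 a collision fixes c and replaces u by |u|σ, so this
is the exchange of directions with c as a parameter. Comparing two integrals avoids the inverse map,
whose direction u/|u| is undefined at u = 0. -/
theorem lintegral_collision [NeZero d] (G : (Vel d × Vel d) × (Vel d × Vel d) → ℝ≥0∞)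
    (hG : Measurable G) :
    ∫⁻ v : Vel d, ∫⁻ w : Vel d, ∫⁻ σ : Sph d,
        G ((v, w), (post v w σ, postStar v w σ)) ∂(sphereMeasure d)
      = ∫⁻ v : Vel d, ∫⁻ w : Vel d, ∫⁻ σ : Sph d,
        G ((post v w σ, postStar v w σ), (v, w)) ∂(sphereMeasure d) := by
  have key : ∀ F : Vel d × Vel d × Sph d → ℝ≥0∞, Measurable F →
      ∫⁻ v : Vel d, ∫⁻ w : Vel d, ∫⁻ σ : Sph d, F (v, w, σ) ∂(sphereMeasure d)
      = ∫⁻ u : Vel d, ∫⁻ σ : Sph d, (∫⁻ c : Vel d,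
        F (c + (1 / 2 : ℝ) • u, c - (1 / 2 : ℝ) • u, σ)) ∂(sphereMeasure d) := by
    intro F hF
    have h1 : Measurable fun q : Vel d × Vel d => ∫⁻ σ : Sph d, F (q.1, q.2, σ)
        ∂(sphereMeasure d) :=
      Measurable.lintegral_prod_right' (f := fun q : (Vel d × Vel d) × Sph d =>
        F (q.1.1, q.1.2, q.2)) (by fun_prop)
    calc _ = ∫⁻ v : Vel d, ∫⁻ u : Vel d, ∫⁻ σ : Sph d, F (v, v - u, σ) ∂(sphereMeasure d) := by
          refine lintegral_congr fun v => ?_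
          exact (lintegral_sub_left_eq_self (μ := (volume : Measure (Vel d)))
            (fun w => ∫⁻ σ : Sph d, F (v, w, σ) ∂(sphereMeasure d)) v).symm
      _ = ∫⁻ u : Vel d, ∫⁻ v : Vel d, ∫⁻ σ : Sph d, F (v, v - u, σ) ∂(sphereMeasure d) := by
          refine lintegral_lintegral_swap ?_
          exact (h1.comp (by fun_prop : Measurable fun q : Vel d × Vel d =>
            (q.1, q.1 - q.2))).aemeasurable
      _ = ∫⁻ u : Vel d, ∫⁻ c : Vel d, ∫⁻ σ : Sph d,
            F (c + (1 / 2 : ℝ) • u, c - (1 / 2 : ℝ) • u, σ) ∂(sphereMeasure d) := by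
          refine lintegral_congr fun u => ?_
          rw [← lintegral_add_right_eq_self _ ((1 / 2 : ℝ) • u)]
          refine lintegral_congr fun c => ?_
          have : c + (1 / 2 : ℝ) • u - u = c - (1 / 2 : ℝ) • u := by module
          rw [this]
      _ = _ := by
          refine lintegral_congr fun u => ?_
          refine lintegral_lintegral_swap ?_
          have h2 : Measurable fun q : Vel d × Sph d =>
              (q.1 + (1 / 2 : ℝ) • u, q.1 - (1 / 2 : ℝ) • u, q.2) := by fun_prop
          exact (hF.comp h2).aemeasurable
  have hp := (continuous_post (d := d)).measurable
  have hps := (continuous_postStar (d := d)).measurable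
  rw [key (fun p => G ((p.1, p.2.1), (post p.1 p.2.1 p.2.2, postStar p.1 p.2.1 p.2.2)))
      (by fun_prop),
    key (fun p => G ((post p.1 p.2.1 p.2.2, postStar p.1 p.2.1 p.2.2), (p.1, p.2.1)))
      (by fun_prop)]
  have hm : Measurable fun q : (Vel d × Vel d) × Vel d =>
      G ((q.2 + (1 / 2 : ℝ) • q.1.1, q.2 - (1 / 2 : ℝ) • q.1.1),
        (q.2 + (1 / 2 : ℝ) • q.1.2, q.2 - (1 / 2 : ℝ) • q.1.2)) := by
    fun_prop
  have hswap := lintegral_sphere_swap (fun q : Vel d × Vel d => ∫⁻ c : Vel d,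
      G ((c + (1 / 2 : ℝ) • q.1, c - (1 / 2 : ℝ) • q.1),
        (c + (1 / 2 : ℝ) • q.2, c - (1 / 2 : ℝ) • q.2))) hm.lintegral_prod_right'
  have hpost : ∀ (c u : Vel d) (σ : Sph d),
      post (c + (1 / 2 : ℝ) • u) (c - (1 / 2 : ℝ) • u) σ = c + (1 / 2 : ℝ) • ‖u‖ • (σ : Vel d) := by
    intro c u σ
    have : c + (1 / 2 : ℝ) • u - (c - (1 / 2 : ℝ) • u) = u := by module
    rw [post, this]
    module
  have hpostStar : ∀ (c u : Vel d) (σ : Sph d),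
      postStar (c + (1 / 2 : ℝ) • u) (c - (1 / 2 : ℝ) • u) σ
        = c - (1 / 2 : ℝ) • ‖u‖ • (σ : Vel d) := by
    intro c u σ
    have : c + (1 / 2 : ℝ) • u - (c - (1 / 2 : ℝ) • u) = u := by module
    rw [postStar, this]
    module
  simpa only [hpost, hpostStar] using hswap

/-- The pre-post-collisional change of variables preserves `dv dw dσ`. -/
theorem map_collision [NeZero d] :
    Measure.map (fun p : Vel d × Vel d × Sph d =>
        ((p.1, p.2.1), (post p.1 p.2.1 p.2.2, postStar p.1 p.2.1 p.2.2)))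
      ((volume : Measure (Vel d)).prod ((volume : Measure (Vel d)).prod (sphereMeasure d)))
    = Measure.map (fun p : Vel d × Vel d × Sph d =>
        ((post p.1 p.2.1 p.2.2, postStar p.1 p.2.1 p.2.2), (p.1, p.2.1)))
      ((volume : Measure (Vel d)).prod ((volume : Measure (Vel d)).prod (sphereMeasure d))) := by
  have hp := (continuous_post (d := d)).measurable
  have hps := (continuous_postStar (d := d)).measurable
  refine Measure.ext_of_lintegral _ fun G hG => ?_
  rw [lintegral_map hG (by fun_prop), lintegral_map hG (by fun_prop)]
  have key : ∀ F : Vel d × Vel d × Sph d → ℝ≥0∞, Measurable F →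
      ∫⁻ p, F p ∂((volume : Measure (Vel d)).prod
        ((volume : Measure (Vel d)).prod (sphereMeasure d)))
      = ∫⁻ v : Vel d, ∫⁻ w : Vel d, ∫⁻ σ : Sph d, F (v, w, σ) ∂(sphereMeasure d) := by
    intro F hF
    rw [lintegral_prod _ hF.aemeasurable]
    refine lintegral_congr fun v => ?_
    rw [lintegral_prod]
    exact (hF.comp measurable_prodMk_left).aemeasurable
  rw [key _ (by fun_prop), key _ (by fun_prop)]
  exact lintegral_collision G hG

end ChangeOfVariables

/-! ### Weak formulation for a law and its admissible test functions -/

noncomputable section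

open Filter Topology

variable {d : ℕ}

/-- The law of `(v, v_*, σ)` when `v` and `v_*` are independent with law `μ` and `σ` is uniform. -/
def collisionMeasure (μ : Measure (Vel d)) : Measure (Vel d × Vel d × Sph d) :=
  μ.prod (μ.prod (sphereMeasure d))

/-- `∫ Q⁻(μ,μ)`. -/
def collisionRate (μ : Measure (Vel d)) : ℝ :=
  ∫ p, ‖p.1 - p.2.1‖ ∂(collisionMeasure μ)

/-- `∫ |ξ|² Q⁻(μ,μ)`. -/
def collisionEnergy (μ : Measure (Vel d)) : ℝ :=
  ∫ p, ‖p.1 - p.2.1‖ * ‖p.1‖ ^ 2 ∂(collisionMeasure μ)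

/-- The drift coefficient `B` in terms of the moments of `Q⁻`. -/
def driftCoeff (α : ℝ) (μ : Measure (Vel d)) : ℝ :=
  α / d * collisionEnergy μ - α / 2 * collisionRate μ

/-- The weak formulation tested with `φ`, where `D` stands for `ξ·∇φ`. -/
def WeakIdentity (α : ℝ) (μ : Measure (Vel d)) (φ D : Vel d → ℝ) : Prop :=
  ∫ p, ‖p.1 - p.2.1‖ * φ p.1 ∂(collisionMeasure μ)
    = (1 - α) * ∫ p, ‖p.1 - p.2.1‖ * φ (post p.1 p.2.1 p.2.2) ∂(collisionMeasure μ)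
      + α * collisionRate μ * ∫ ξ, φ ξ ∂μ + driftCoeff α μ * ∫ ξ, D ξ ∂μ

instance [NeZero d] (μ : Measure (Vel d)) [IsProbabilityMeasure μ] :
    IsProbabilityMeasure (collisionMeasure μ) := by
  unfold collisionMeasure; infer_instance

theorem pow_le_one_add_pow {t : ℝ} (ht : 0 ≤ t) {k l : ℕ} (h : k ≤ l) : t ^ k ≤ 1 + t ^ l := by
  rcases le_total t 1 with h1 | h1
  · exact (pow_le_one₀ ht h1).trans (by linarith [pow_nonneg ht l])
  · exact (pow_le_pow_right₀ h1 h).trans (by linarith)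

theorem integrable_norm_pow_of_le {μ : Measure (Vel d)} [IsFiniteMeasure μ] {k l : ℕ}
    (hl : Integrable (fun ξ : Vel d => ‖ξ‖ ^ l) μ) (h : k ≤ l) :
    Integrable (fun ξ : Vel d => ‖ξ‖ ^ k) μ := by
  refine ((integrable_const (1 : ℝ)).add hl).mono' (by fun_prop) (Eventually.of_forall fun ξ => ?_)
  rw [Real.norm_of_nonneg (by positivity)]
  exact pow_le_one_add_pow (norm_nonneg _) h

theorem integrable_growth {μ : Measure (Vel d)} [IsFiniteMeasure μ] {k : ℕ}
    (hk : Integrable (fun ξ : Vel d => ‖ξ‖ ^ k) μ) {f : Vel d → ℝ} (hf : Measurable f) {C : ℝ}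
    (hC : ∀ ξ, |f ξ| ≤ C * (1 + ‖ξ‖ ^ k)) : Integrable f μ :=
  (((integrable_const (1 : ℝ)).add hk).const_mul C).mono' hf.aestronglyMeasurable
    (Eventually.of_forall hC)

/-- The kinetic factor |v - w| costs one power: a test function of order k requires a moment of
order k + 1. -/
theorem abs_collision_le {k : ℕ} {φ : Vel d → ℝ} {C : ℝ} (hC0 : 0 ≤ C)
    (hC : ∀ ξ, |φ ξ| ≤ C * (1 + ‖ξ‖ ^ k)) {v w z : Vel d} (hz : ‖z‖ ≤ ‖v‖ + ‖w‖) :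
    |‖v - w‖ * φ z| ≤ C * 2 ^ (k + 1) * (1 + ‖v‖ ^ (k + 1) + ‖w‖ ^ (k + 1)) := by
  have hr := norm_nonneg v
  have hs := norm_nonneg w
  have h1 : ‖v - w‖ ≤ ‖v‖ + ‖w‖ := norm_sub_le v w
  have h2 : |φ z| ≤ C * (1 + (‖v‖ + ‖w‖) ^ k) :=
    (hC z).trans (by gcongr)
  have h3 : ‖v‖ + ‖w‖ ≤ 1 + (‖v‖ + ‖w‖) ^ (k + 1) := by
    simpa using pow_le_one_add_pow (add_nonneg hr hs) (k := 1) (l := k + 1) (by omega)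
  have h4 : (‖v‖ + ‖w‖) ^ (k + 1) ≤ 2 ^ k * (‖v‖ ^ (k + 1) + ‖w‖ ^ (k + 1)) := by
    simpa using add_pow_le hr hs (k + 1)
  have h5 : (1 : ℝ) ≤ 2 ^ (k + 1) := one_le_pow₀ (by norm_num)
  rw [abs_mul, abs_of_nonneg (norm_nonneg _)]
  calc ‖v - w‖ * |φ z| ≤ (‖v‖ + ‖w‖) * (C * (1 + (‖v‖ + ‖w‖) ^ k)) := by gcongr
    _ = C * ((‖v‖ + ‖w‖) + (‖v‖ + ‖w‖) ^ (k + 1)) := by ring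
    _ ≤ C * (1 + 2 * (2 ^ k * (‖v‖ ^ (k + 1) + ‖w‖ ^ (k + 1)))) :=
        mul_le_mul_of_nonneg_left (by linarith) hC0
    _ ≤ C * (2 ^ (k + 1) + 2 * (2 ^ k * (‖v‖ ^ (k + 1) + ‖w‖ ^ (k + 1)))) := by gcongr
    _ = _ := by ring

theorem integrable_collision_bound [NeZero d] {μ : Measure (Vel d)} [IsProbabilityMeasure μ]
    {k : ℕ} (hk : Integrable (fun ξ : Vel d => ‖ξ‖ ^ k) μ) :
    Integrable (fun p : Vel d × Vel d × Sph d => 1 + ‖p.1‖ ^ k + ‖p.2.1‖ ^ k)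
      (collisionMeasure μ) := by
  refine ((integrable_const 1).add (hk.comp_fst (μ.prod (sphereMeasure d)))).add ?_
  exact (hk.comp_fst (sphereMeasure d)).comp_snd μ

/-- Collision integrals of functions of polynomial growth converge. -/
theorem integrable_collision [NeZero d] {μ : Measure (Vel d)} [IsProbabilityMeasure μ] {k : ℕ}
    (hk : Integrable (fun ξ : Vel d => ‖ξ‖ ^ (k + 1)) μ) {φ : Vel d → ℝ} (hφ : Measurable φ)
    {C : ℝ} (hC : ∀ ξ, |φ ξ| ≤ C * (1 + ‖ξ‖ ^ k)) {Z : Vel d × Vel d × Sph d → Vel d}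
    (hZ : Measurable Z) (hZle : ∀ p, ‖Z p‖ ≤ ‖p.1‖ + ‖p.2.1‖) :
    Integrable (fun p => ‖p.1 - p.2.1‖ * φ (Z p)) (collisionMeasure μ) := by
  have hC0 : 0 ≤ C := by
    have := (abs_nonneg _).trans (hC 0)
    exact nonneg_of_mul_nonneg_left this (by positivity)
  refine ((integrable_collision_bound hk).const_mul (C * 2 ^ (k + 1))).mono' ?_
    (Eventually.of_forall fun p => abs_collision_le hC0 hC (hZle p))
  exact (Measurable.mul (by fun_prop) (hφ.comp hZ)).aestronglyMeasurable

/-- The weak formulation is stable under pointwise limits dominated by a power. -/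
theorem WeakIdentity.of_tendsto [NeZero d] {α : ℝ} {μ : Measure (Vel d)} [IsProbabilityMeasure μ]
    {k : ℕ} (hk : Integrable (fun ξ : Vel d => ‖ξ‖ ^ (k + 1)) μ) {C : ℝ}
    {φ D : Vel d → ℝ} {φn Dn : ℕ → Vel d → ℝ}
    (hφn : ∀ n, Measurable (φn n)) (hDn : ∀ n, Measurable (Dn n))
    (hC : ∀ n ξ, |φn n ξ| ≤ C * (1 + ‖ξ‖ ^ k)) (hCD : ∀ n ξ, |Dn n ξ| ≤ C * (1 + ‖ξ‖ ^ k))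
    (hφ : ∀ ξ, Tendsto (fun n => φn n ξ) atTop (𝓝 (φ ξ)))
    (hD : ∀ ξ, Tendsto (fun n => Dn n ξ) atTop (𝓝 (D ξ)))
    (h : ∀ n, WeakIdentity α μ (φn n) (Dn n)) : WeakIdentity α μ φ D := by
  have hC0 : 0 ≤ C := by
    have := (abs_nonneg _).trans (hC 0 0)
    exact nonneg_of_mul_nonneg_left this (by positivity)
  have hk0 := integrable_norm_pow_of_le hk (Nat.le_succ k)
  have lim1 : ∀ (Z : Vel d × Vel d × Sph d → Vel d), Measurable Z →
      (∀ p, ‖Z p‖ ≤ ‖p.1‖ + ‖p.2.1‖) →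
      Tendsto (fun n => ∫ p, ‖p.1 - p.2.1‖ * φn n (Z p) ∂(collisionMeasure μ)) atTop
        (𝓝 (∫ p, ‖p.1 - p.2.1‖ * φ (Z p) ∂(collisionMeasure μ))) := by
    intro Z hZ hZle
    refine tendsto_integral_of_dominated_convergence
      (fun p => C * 2 ^ (k + 1) * (1 + ‖p.1‖ ^ (k + 1) + ‖p.2.1‖ ^ (k + 1))) (fun n => ?_)
      ((integrable_collision_bound hk).const_mul _) (fun n => Eventually.of_forall fun p =>
        abs_collision_le hC0 (hC n) (hZle p))
      (Eventually.of_forall fun p => (hφ _).const_mul _)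
    exact (Measurable.mul (by fun_prop) ((hφn n).comp hZ)).aestronglyMeasurable
  have lim2 : ∀ (f : Vel d → ℝ) (fn : ℕ → Vel d → ℝ), (∀ n, Measurable (fn n)) →
      (∀ n ξ, |fn n ξ| ≤ C * (1 + ‖ξ‖ ^ k)) →
      (∀ ξ, Tendsto (fun n => fn n ξ) atTop (𝓝 (f ξ))) →
      Tendsto (fun n => ∫ ξ, fn n ξ ∂μ) atTop (𝓝 (∫ ξ, f ξ ∂μ)) := by
    intro f fn hfn hfC hf
    exact tendsto_integral_of_dominated_convergence (fun ξ => C * (1 + ‖ξ‖ ^ k))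
      (fun n => (hfn n).aestronglyMeasurable) (((integrable_const (1 : ℝ)).add hk0).const_mul C)
      (fun n => Eventually.of_forall (hfC n)) (Eventually.of_forall hf)
  have l1 := lim1 Prod.fst measurable_fst (fun p => by linarith [norm_nonneg p.2.1])
  have l2 := lim1 _ (continuous_post (d := d)).measurable (fun p => norm_post_le _ _ _)
  have l3 := lim2 φ φn hφn hC hφ
  have l4 := lim2 D Dn hDn hCD hD
  refine tendsto_nhds_unique l1 ((((l2.const_mul (1 - α)).add
    (l3.const_mul (α * collisionRate μ))).add (l4.const_mul (driftCoeff α μ))).congr fun n => ?_)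
  exact (h n).symm

/-- Test functions of polynomial growth are admissible when enough moments are finite. -/
theorem WeakIdentity.of_growth [NeZero d] {α : ℝ} {μ : Measure (Vel d)} [IsProbabilityMeasure μ]
    (hμ : ∀ φ : Vel d → ℝ, ContDiff ℝ ∞ φ → HasCompactSupport φ →
      WeakIdentity α μ φ fun ξ => fderiv ℝ φ ξ ξ)
    {k : ℕ} (hk : Integrable (fun ξ : Vel d => ‖ξ‖ ^ (k + 1)) μ) {C : ℝ} {φ : Vel d → ℝ}
    (hφ : ContDiff ℝ ∞ φ) (hC : ∀ ξ, |φ ξ| ≤ C * (1 + ‖ξ‖ ^ k))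
    (hCD : ∀ ξ, |fderiv ℝ φ ξ ξ| ≤ C * (1 + ‖ξ‖ ^ k)) :
    WeakIdentity α μ φ fun ξ => fderiv ℝ φ ξ ξ := by
  have hC0 : 0 ≤ C := by
    have := (abs_nonneg _).trans (hC 0)
    exact nonneg_of_mul_nonneg_left this (by positivity)
  -- The test function is cut off by χ(ξ/(n+1)). Since ξ·∇ is invariant under dilations, the
  -- derivative of the cutoff contributes η·∇χ(η) at η = ξ/(n+1), which is bounded by one constant K
  -- for all n.
  let χ : ContDiffBump (0 : Vel d) := ⟨1, 2, one_pos, one_lt_two⟩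
  have hχ : ContDiff ℝ ∞ χ := χ.contDiff
  have hχd : Differentiable ℝ χ := hχ.differentiable (by simp)
  have hφd : Differentiable ℝ φ := hφ.differentiable (by simp)
  obtain ⟨K, hK⟩ : ∃ K, ∀ η : Vel d, ‖fderiv ℝ χ η η‖ ≤ K := by
    refine HasCompactSupport.exists_bound_of_continuous ?_ ?_
    · refine (χ.hasCompactSupport.fderiv ℝ).mono fun η hη => ?_
      simp only [Function.mem_support] at hη ⊢
      intro h0
      exact hη (by simp [h0])
    · exact (hχ.continuous_fderiv (by simp)).clm_apply continuous_id
  have hK0 : 0 ≤ K := (norm_nonneg _).trans (hK 0)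
  set c : ℕ → ℝ := fun n => ((n : ℝ) + 1)⁻¹ with hc
  have hc0 : ∀ n, 0 < c n := fun n => by positivity
  have hcut : ∀ n, ContDiff ℝ ∞ fun ξ => χ (c n • ξ) * φ ξ := fun n =>
    (hχ.comp (contDiff_const_smul _)).mul hφ
  have hder : ∀ n ξ, fderiv ℝ (fun ξ => χ (c n • ξ) * φ ξ) ξ ξ
      = χ (c n • ξ) * fderiv ℝ φ ξ ξ + φ ξ * fderiv ℝ χ (c n • ξ) (c n • ξ) := by
    intro n ξ
    have h1 : HasFDerivAt (fun ξ => χ (c n • ξ))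
        ((fderiv ℝ χ (c n • ξ)).comp (c n • ContinuousLinearMap.id ℝ (Vel d))) ξ :=
      (hχd (c n • ξ)).hasFDerivAt.comp ξ ((hasFDerivAt_id ξ).const_smul (c n))
    rw [(h1.fun_mul (hφd ξ).hasFDerivAt).fderiv]
    simp
  have hev : ∀ ξ : Vel d, ∀ᶠ n in atTop, c n • ξ ∈ Metric.ball (0 : Vel d) χ.rIn := by
    intro ξ
    have : Tendsto (fun n => c n • ξ) atTop (𝓝 0) := by
      have h0 : Tendsto c atTop (𝓝 0) := by
        simpa [hc, one_div] using tendsto_one_div_add_atTop_nhds_zero_nat (𝕜 := ℝ)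
      simpa using h0.smul_const ξ
    exact this.eventually (Metric.ball_mem_nhds _ χ.rIn_pos)
  have habs : ∀ η, |χ η| ≤ 1 := fun η => by
    rw [abs_of_nonneg χ.nonneg]; exact χ.le_one
  refine WeakIdentity.of_tendsto hk (C := C + C * K)
    (φn := fun n ξ => χ (c n • ξ) * φ ξ)
    (Dn := fun n ξ => fderiv ℝ (fun ξ => χ (c n • ξ) * φ ξ) ξ ξ)
    (fun n => (hcut n).continuous.measurable)
    (fun n => (((hcut n).continuous_fderiv (by simp)).clm_apply continuous_id).measurable)
    (fun n ξ => ?_) (fun n ξ => ?_) (fun ξ => ?_) (fun ξ => ?_) (fun n => hμ _ (hcut n) ?_)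
  · rw [abs_mul]
    calc _ ≤ 1 * (C * (1 + ‖ξ‖ ^ k)) := by gcongr; exacts [habs _, hC ξ]
      _ ≤ (C + C * K) * (1 + ‖ξ‖ ^ k) := by
        have : 0 ≤ C * K * (1 + ‖ξ‖ ^ k) := by positivity
        linarith
  · rw [hder]
    refine (abs_add_le _ _).trans ?_
    rw [abs_mul, abs_mul]
    calc _ ≤ 1 * (C * (1 + ‖ξ‖ ^ k)) + (C * (1 + ‖ξ‖ ^ k)) * K := by
          gcongr
          exacts [habs _, hCD ξ, hC ξ, hK _]
      _ = _ := by ring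
  · refine tendsto_const_nhds.congr' ?_
    filter_upwards [hev ξ] with n hn
    rw [χ.one_of_mem_closedBall (Metric.ball_subset_closedBall hn), one_mul]
  · refine tendsto_const_nhds.congr' ?_
    filter_upwards [hev ξ] with n hn
    rw [hder, χ.one_of_mem_closedBall (Metric.ball_subset_closedBall hn), one_mul,
      (χ.eventuallyEq_one_of_mem_ball hn).fderiv_eq]
    simp
  · refine HasCompactSupport.mul_right ?_
    exact χ.hasCompactSupport.comp_homeomorph (Homeomorph.smulOfNeZero (c n) (hc0 n).ne')

/-! ### Profiles as probability laws -/

/-- The moment information carried by a profile: a centred law with energy `d/2` and a finite third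
moment that solves the stationary equation in weak form. -/
structure IsProfileLaw (α : ℝ) (μ : Measure (Vel d)) : Prop where
  momentum : ∫ ξ, ξ ∂μ = 0
  energy : ∫ ξ, ‖ξ‖ ^ 2 ∂μ = (d : ℝ) / 2
  integrable : Integrable (fun ξ : Vel d => ‖ξ‖ ^ 3) μ
  weak : ∀ φ : Vel d → ℝ, ContDiff ℝ ∞ φ → HasCompactSupport φ →
    WeakIdentity α μ φ fun ξ => fderiv ℝ φ ξ ξ

/-- The probability measure with density `ψ`. -/
def profileMeasure (ψ : Vel d → ℝ) : Measure (Vel d) :=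
  volume.withDensity fun ξ => ENNReal.ofReal (ψ ξ)

section Density

variable {ψ : Vel d → ℝ}

theorem integral_profileMeasure (hm : Measurable ψ) (h0 : ∀ ξ, 0 ≤ ψ ξ) {F : Type*}
    [NormedAddCommGroup F] [NormedSpace ℝ F] (f : Vel d → F) :
    ∫ ξ, f ξ ∂(profileMeasure ψ) = ∫ ξ, ψ ξ • f ξ := by
  rw [profileMeasure, integral_withDensity_eq_integral_toReal_smul (by fun_prop) (by simp)]
  simp [ENNReal.toReal_ofReal, h0]

theorem integrable_profileMeasure (hm : Measurable ψ) (h0 : ∀ ξ, 0 ≤ ψ ξ) {F : Type*}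
    [NormedAddCommGroup F] [NormedSpace ℝ F] (f : Vel d → F) :
    Integrable f (profileMeasure ψ) ↔ Integrable fun ξ => ψ ξ • f ξ := by
  rw [profileMeasure, integrable_withDensity_iff_integrable_smul' (by fun_prop) (by simp)]
  simp [ENNReal.toReal_ofReal, h0]

/-- `dv dw dσ`. -/
def collisionVolume (d : ℕ) : Measure (Vel d × Vel d × Sph d) :=
  (volume : Measure (Vel d)).prod ((volume : Measure (Vel d)).prod (sphereMeasure d))

theorem collisionMeasure_profileMeasure (hm : Measurable ψ) (h0 : ∀ ξ, 0 ≤ ψ ξ) :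
    collisionMeasure (profileMeasure ψ) = (collisionVolume d).withDensity
      fun p => ENNReal.ofReal (ψ p.1 * ψ p.2.1) := by
  have hm' : Measurable fun ξ => ENNReal.ofReal (ψ ξ) := by fun_prop
  have hinner : (volume.withDensity fun ξ => ENNReal.ofReal (ψ ξ)).prod (sphereMeasure d)
      = ((volume : Measure (Vel d)).prod (sphereMeasure d)).withDensity
        fun z => ENNReal.ofReal (ψ z.1) := prod_withDensity_left hm'
  rw [collisionMeasure, profileMeasure, hinner, prod_withDensity hm' (by fun_prop),
    collisionVolume]
  congr 1
  ext p
  rw [ENNReal.ofReal_mul (h0 _)]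

theorem integral_collisionMeasure (hm : Measurable ψ) (h0 : ∀ ξ, 0 ≤ ψ ξ)
    (f : Vel d × Vel d × Sph d → ℝ) :
    ∫ p, f p ∂(collisionMeasure (profileMeasure ψ))
      = ∫ p, ψ p.1 * ψ p.2.1 * f p ∂(collisionVolume d) := by
  rw [collisionMeasure_profileMeasure hm h0,
    integral_withDensity_eq_integral_toReal_smul (by fun_prop) (by simp)]
  simp [ENNReal.toReal_ofReal, h0]

theorem integrable_collisionMeasure (hm : Measurable ψ) (h0 : ∀ ξ, 0 ≤ ψ ξ)
    (f : Vel d × Vel d × Sph d → ℝ) :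
    Integrable f (collisionMeasure (profileMeasure ψ))
      ↔ Integrable (fun p => ψ p.1 * ψ p.2.1 * f p) (collisionVolume d) := by
  rw [collisionMeasure_profileMeasure hm h0,
    integrable_withDensity_iff_integrable_smul' (by fun_prop) (by simp)]
  simp [ENNReal.toReal_ofReal, h0]

theorem loss_eq (hm : Measurable ψ) (h0 : ∀ ξ, 0 ≤ ψ ξ) (v : Vel d) :
    loss ψ ψ v = ψ v * ∫ w, ‖v - w‖ ∂(profileMeasure ψ) := by
  rw [loss, integral_profileMeasure hm h0]
  simp [mul_comm]

theorem integral_collision_fst [NeZero d] {μ : Measure (Vel d)} [IsProbabilityMeasure μ]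
    {φ : Vel d → ℝ}
    (h : Integrable (fun p => ‖p.1 - p.2.1‖ * φ p.1) (collisionMeasure μ)) :
    ∫ p, ‖p.1 - p.2.1‖ * φ p.1 ∂(collisionMeasure μ)
      = ∫ v, φ v * ∫ w, ‖v - w‖ ∂μ ∂μ := by
  rw [collisionMeasure, integral_prod _ h]
  refine integral_congr_ae (Eventually.of_forall fun v => ?_)
  dsimp only
  rw [integral_mul_const, mul_comm]
  congr 1
  rw [integral_fun_fst (fun w => ‖v - w‖)]
  simp

theorem integrable_collision_fst [NeZero d] {μ : Measure (Vel d)} [IsProbabilityMeasure μ]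
    {φ : Vel d → ℝ}
    (h : Integrable (fun p => ‖p.1 - p.2.1‖ * φ p.1) (collisionMeasure μ)) :
    Integrable (fun v => φ v * ∫ w, ‖v - w‖ ∂μ) μ := by
  refine h.integral_prod_left.congr (Eventually.of_forall fun v => ?_)
  dsimp only
  rw [integral_mul_const, mul_comm]
  congr 1
  rw [integral_fun_fst (fun w => ‖v - w‖)]
  simp

/-- Jensen's inequality for the collision frequency of a centred law. -/
theorem norm_le_integral_norm_sub {μ : Measure (Vel d)} [IsProbabilityMeasure μ]
    (h1 : Integrable (fun ξ : Vel d => ξ) μ) (h0 : ∫ ξ, ξ ∂μ = 0) (v : Vel d) :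
    ‖v‖ ≤ ∫ w, ‖v - w‖ ∂μ := by
  calc ‖v‖ = ‖∫ w, (v - w) ∂μ‖ := by
        rw [integral_sub (integrable_const _) h1, h0]; simp
    _ ≤ _ := norm_integral_le_integral_norm _

/-- Weak form of the gain operator. -/
theorem integral_gain_mul [NeZero d] (hm : Measurable ψ) (h0 : ∀ ξ, 0 ≤ ψ ξ) {φ : Vel d → ℝ}
    (hφ : Measurable φ)
    (h : Integrable (fun p => ‖p.1 - p.2.1‖ * φ (post p.1 p.2.1 p.2.2))
      (collisionMeasure (profileMeasure ψ))) :
    Integrable (fun v => gain ψ ψ v * φ v) ∧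
    ∫ v, gain ψ ψ v * φ v = ∫ p, ‖p.1 - p.2.1‖ * φ (post p.1 p.2.1 p.2.2)
      ∂(collisionMeasure (profileMeasure ψ)) := by
  have hp := (continuous_post (d := d)).measurable
  have hps := (continuous_postStar (d := d)).measurable
  -- H carries ψ on the first pair of velocities and φ on the second. Its pushforwards under the two
  -- collision maps are the weak gain integral and ∫ Q⁺φ; the relative speed is the same for both
  -- pairs.
  set H : (Vel d × Vel d) × (Vel d × Vel d) → ℝ :=
    fun q => ψ q.1.1 * ψ q.1.2 * (‖q.1.1 - q.1.2‖ * φ q.2.1) with hH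
  have hHm : Measurable H := by fun_prop
  have hT1 : Measurable fun p : Vel d × Vel d × Sph d =>
        ((p.1, p.2.1), (post p.1 p.2.1 p.2.2, postStar p.1 p.2.1 p.2.2)) := by fun_prop
  have hT2 : Measurable fun p : Vel d × Vel d × Sph d =>
        ((post p.1 p.2.1 p.2.2, postStar p.1 p.2.1 p.2.2), (p.1, p.2.1)) := by fun_prop
  have e2 : ∀ v : Vel d, ∀ q : Vel d × Sph d,
      ψ (post v q.1 q.2) * ψ (postStar v q.1 q.2) *
        (‖post v q.1 q.2 - postStar v q.1 q.2‖ * φ v)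
      = ‖v - q.1‖ * (ψ (post v q.1 q.2) * ψ (postStar v q.1 q.2)) * φ v := by
    intro v q
    rw [norm_post_sub_postStar]; ring
  rw [integrable_collisionMeasure hm h0] at h
  rw [integral_collisionMeasure hm h0]
  have i1 : Integrable H (Measure.map (fun p : Vel d × Vel d × Sph d =>
        ((p.1, p.2.1), (post p.1 p.2.1 p.2.2, postStar p.1 p.2.1 p.2.2))) (collisionVolume d)) := by
    rw [integrable_map_measure hHm.aestronglyMeasurable hT1.aemeasurable]
    exact h
  have i1' := i1
  rw [collisionVolume, map_collision,
    integrable_map_measure hHm.aestronglyMeasurable hT2.aemeasurable] at i1'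
  have i2 : ∫ p, H ((p.1, p.2.1), (post p.1 p.2.1 p.2.2, postStar p.1 p.2.1 p.2.2))
        ∂(collisionVolume d)
      = ∫ p, H ((post p.1 p.2.1 p.2.2, postStar p.1 p.2.1 p.2.2), (p.1, p.2.1))
        ∂(collisionVolume d) := by
    rw [← integral_map (f := H) hT1.aemeasurable hHm.aestronglyMeasurable,
      ← integral_map (f := H) hT2.aemeasurable hHm.aestronglyMeasurable, collisionVolume,
      map_collision]
  have e3 : ∀ v, gain ψ ψ v * φ v
      = ∫ q, H ((post v q.1 q.2, postStar v q.1 q.2), (v, q.1))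
        ∂((volume : Measure (Vel d)).prod (sphereMeasure d)) := by
    intro v
    simp only [hH, e2]
    rw [integral_mul_const, gain]
  refine ⟨i1'.integral_prod_left.congr (Eventually.of_forall fun v => (e3 v).symm), ?_⟩
  refine Eq.trans ?_ i2.symm
  rw [collisionVolume]
  refine Eq.trans ?_ (integral_prod _ i1').symm
  exact integral_congr_ae (Eventually.of_forall e3)

end Density

theorem IsProfile.isProbabilityMeasure {α : ℝ} {ψ : Vel d → ℝ} (h : IsProfile α ψ) :
    IsProbabilityMeasure (profileMeasure ψ) := by
  refine ⟨?_⟩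
  have hint : Integrable ψ := by
    -- A non-integrable function has integral 0 by convention, which unit mass excludes.
    by_contra hn
    have := h.mass
    rw [integral_undef hn] at this
    exact zero_ne_one this
  rw [profileMeasure, withDensity_apply _ .univ, Measure.restrict_univ,
    ← ofReal_integral_eq_lintegral_ofReal hint (Eventually.of_forall h.nonneg), h.mass]
  simp

/-- The third moment is finite because |ξ|² Q⁻ is integrable and the collision frequency dominates
|ξ|. The equation takes the form of `WeakIdentity` because the coefficient of ∫ φ dμ, namely -A +
dB, reduces to α times the collision rate: the energy terms cancel. -/
theorem IsProfile.isProfileLaw [NeZero d] {α : ℝ} {ψ : Vel d → ℝ} (h : IsProfile α ψ) :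
    IsProfileLaw α (profileMeasure ψ) := by
  have hm := h.measurable
  have h0 := h.nonneg
  have := h.isProbabilityMeasure
  set μ := profileMeasure ψ with hμ
  have hmom : ∫ ξ, ξ ∂μ = 0 := by
    rw [hμ, integral_profileMeasure hm h0, h.momentum]
  have i2 : Integrable (fun ξ : Vel d => ‖ξ‖ ^ 2) μ := by
    rw [hμ, integrable_profileMeasure hm h0]
    refine h.integrable.mono' (by fun_prop) (Eventually.of_forall fun ξ => ?_)
    have := h0 ξ
    rw [smul_eq_mul, Real.norm_of_nonneg (by positivity)]
    gcongr
    linarith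
  have i1 : Integrable (fun ξ : Vel d => ‖ξ‖) μ := by
    simpa using integrable_norm_pow_of_le i2 (k := 1) (by omega)
  have i1' : Integrable (fun ξ : Vel d => ξ) μ :=
    (integrable_norm_iff (by fun_prop)).1 i1
  have hfreq := fun v => norm_le_integral_norm_sub i1' hmom v
  have hloss : ∀ φ : Vel d → ℝ, ∀ ξ, φ ξ * loss ψ ψ ξ = ψ ξ • (φ ξ * ∫ w, ‖ξ - w‖ ∂μ) := by
    intro φ ξ
    rw [loss_eq hm h0, smul_eq_mul]; ring
  have hen : Integrable (fun ξ : Vel d => ‖ξ‖ ^ 2 * ∫ w, ‖ξ - w‖ ∂μ) μ := by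
    rw [hμ, integrable_profileMeasure hm h0]
    exact h.integrable_coeff.congr (Eventually.of_forall (hloss fun ξ => ‖ξ‖ ^ 2))
  have i3 : Integrable (fun ξ : Vel d => ‖ξ‖ ^ 3) μ := by
    refine hen.mono' (by fun_prop) (Eventually.of_forall fun ξ => ?_)
    rw [Real.norm_of_nonneg (by positivity), pow_succ]
    exact mul_le_mul_of_nonneg_left (hfreq ξ) (by positivity)
  have hlossint : ∀ φ : Vel d → ℝ,
      Integrable (fun p => ‖p.1 - p.2.1‖ * φ p.1) (collisionMeasure μ) →
      Integrable (fun ξ => φ ξ * loss ψ ψ ξ) ∧ ∫ ξ, φ ξ * loss ψ ψ ξ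
        = ∫ p, ‖p.1 - p.2.1‖ * φ p.1 ∂(collisionMeasure μ) := by
    intro φ hφ
    have k1 := integrable_collision_fst hφ
    rw [integral_collision_fst hφ]
    simp only [hloss]
    rw [hμ, integrable_profileMeasure hm h0] at k1
    rw [hμ, integral_profileMeasure hm h0]
    exact ⟨k1, rfl⟩
  have hfst : ∀ p : Vel d × Vel d × Sph d, ‖p.1‖ ≤ ‖p.1‖ + ‖p.2.1‖ := fun p => by
    linarith [norm_nonneg p.2.1]
  have c0 := hlossint (fun _ => 1) (integrable_collision (k := 0) (by simpa using i1)
    measurable_const (C := 1) (by norm_num) measurable_fst hfst)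
  have c2 := hlossint (fun ξ => ‖ξ‖ ^ 2) (integrable_collision (k := 2) i3 (C := 1)
    (φ := fun ξ => ‖ξ‖ ^ 2) (by fun_prop) (fun ξ => by rw [abs_of_nonneg (by positivity)]; linarith) measurable_fst hfst)
  simp only [one_mul, mul_one] at c0
  have hlin : ∀ s : ℝ, ∫ ξ, (s - 2 * ‖ξ‖ ^ 2) * loss ψ ψ ξ
      = s * (∫ ξ, loss ψ ψ ξ) - 2 * ∫ ξ, ‖ξ‖ ^ 2 * loss ψ ψ ξ := by
    intro s
    rw [← integral_const_mul, ← integral_const_mul,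
      ← integral_sub (c0.1.const_mul _) (c2.1.const_mul _)]
    congr 1
    ext ξ
    ring
  have hA : coeffA α ψ
      = -(α / 2) * ((d + 2) * collisionRate μ - 2 * collisionEnergy μ) := by
    rw [coeffA, collisionRate, collisionEnergy, ← c0.2, ← c2.2, hlin]
  have hB : coeffB α ψ
      = -(α / (2 * d)) * (d * collisionRate μ - 2 * collisionEnergy μ) := by
    rw [coeffB, collisionRate, collisionEnergy, ← c0.2, ← c2.2, hlin]
  refine ⟨hmom, ?_, i3, fun φ hφ hφc => ?_⟩
  · rw [hμ, integral_profileMeasure hm h0]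
    exact h.energy
  · have hφm : Measurable φ := hφ.continuous.measurable
    obtain ⟨C, hC⟩ := hφc.exists_bound_of_continuous hφ.continuous
    have hC' : ∀ ξ, |φ ξ| ≤ C * (1 + ‖ξ‖ ^ 0) := fun ξ => by
      have hn := (abs_nonneg _).trans (hC ξ)
      have := hC ξ
      rw [Real.norm_eq_abs] at this
      rw [pow_zero]
      linarith
    have cl := hlossint φ (integrable_collision (k := 0) (by simpa using i1) hφm hC'
      measurable_fst hfst)
    have cg := integral_gain_mul hm h0 hφm (integrable_collision (k := 0) (by simpa using i1) hφm
      hC' continuous_post.measurable (fun p => norm_post_le _ _ _))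
    have hD : Continuous fun ξ => fderiv ℝ φ ξ ξ :=
      (hφ.continuous_fderiv (by simp)).clm_apply continuous_id
    have hDc : HasCompactSupport fun ξ => fderiv ℝ φ ξ ξ := by
      refine (hφc.fderiv ℝ).mono fun η hη => ?_
      simp only [Function.mem_support] at hη ⊢
      intro hz
      exact hη (by simp [hz])
    obtain ⟨K, hK⟩ := hDc.exists_bound_of_continuous hD
    have iφ : Integrable (fun ξ => ψ ξ * φ ξ) :=
      (integrable_profileMeasure hm h0 φ).1
        ((integrable_const C).mono' (by fun_prop) (Eventually.of_forall hC))
    have iD : Integrable (fun ξ => ψ ξ * fderiv ℝ φ ξ ξ) :=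
      (integrable_profileMeasure hm h0 fun ξ => fderiv ℝ φ ξ ξ).1
        ((integrable_const K).mono' hD.aestronglyMeasurable (Eventually.of_forall hK))
    have hw := h.equation φ hφ hφc
    have e1 : ∫ ξ, ψ ξ * ((d : ℝ) * φ ξ + fderiv ℝ φ ξ ξ)
        = d * ∫ ξ, φ ξ ∂μ + ∫ ξ, fderiv ℝ φ ξ ξ ∂μ := by
      rw [hμ, integral_profileMeasure hm h0, integral_profileMeasure hm h0, ← integral_const_mul]
      simp only [smul_eq_mul]
      rw [← integral_add (iφ.const_mul _) iD]
      congr 1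
      ext ξ
      ring
    have e2 : ∫ ξ, annihilation α ψ ξ * φ ξ
        = (1 - α) * ∫ p, ‖p.1 - p.2.1‖ * φ (post p.1 p.2.1 p.2.2) ∂(collisionMeasure μ)
          - ∫ p, ‖p.1 - p.2.1‖ * φ p.1 ∂(collisionMeasure μ) := by
      rw [← cl.2, ← cg.2, ← integral_const_mul, ← integral_sub (cg.1.const_mul _) cl.1]
      congr 1
      ext ξ
      rw [annihilation, boltzmann]
      ring
    have e3 : ∫ ξ, ψ ξ * φ ξ = ∫ ξ, φ ξ ∂μ := by
      rw [hμ, integral_profileMeasure hm h0]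
      rfl
    rw [e1, e2, e3, hA, hB] at hw
    have hd : (d : ℝ) ≠ 0 := by exact_mod_cast NeZero.ne d
    rw [WeakIdentity, driftCoeff]
    field_simp at hw ⊢
    linarith

/-! ### Symmetries of the collision integral; comparison of gain and loss -/

section Symmetry

theorem collisionMeasure_eq_map [NeZero d] (μ : Measure (Vel d)) [IsProbabilityMeasure μ] :
    MeasurePreserving (MeasurableEquiv.prodAssoc : (Vel d × Vel d) × Sph d ≃ᵐ Vel d × Vel d × Sph d)
      ((μ.prod μ).prod (sphereMeasure d)) (collisionMeasure μ) :=
  measurePreserving_prodAssoc μ μ (sphereMeasure d)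

theorem measurePreserving_exchange [NeZero d] (μ : Measure (Vel d)) [IsProbabilityMeasure μ] :
    MeasurePreserving (fun p : Vel d × Vel d × Sph d => (p.2.1, p.1, p.2.2))
      (collisionMeasure μ) (collisionMeasure μ) := by
  have h := collisionMeasure_eq_map μ
  have h2 : MeasurePreserving (Prod.swap : Vel d × Vel d → Vel d × Vel d) (μ.prod μ) (μ.prod μ) :=
    Measure.measurePreserving_swap
  exact (h.comp (h2.prod (MeasurePreserving.id (sphereMeasure d)))).comp h.symm

theorem measurePreserving_reflect [NeZero d] (μ : Measure (Vel d)) [IsProbabilityMeasure μ] :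
    MeasurePreserving (fun p : Vel d × Vel d × Sph d =>
        (p.1, p.2.1, sphereMap (LinearIsometryEquiv.neg ℝ) p.2.2))
      (collisionMeasure μ) (collisionMeasure μ) :=
  (MeasurePreserving.id μ).prod ((MeasurePreserving.id μ).prod (measurePreserving_sphereMap _))

theorem integral_comp_of_measurePreserving {X : Type*} [MeasurableSpace X] {P : Measure X}
    {T : X → X} (hT : MeasurePreserving T P P) {f : X → ℝ} (hf : Measurable f) :
    ∫ x, f (T x) ∂P = ∫ x, f x ∂P := by
  conv_rhs => rw [← hT.map_eq]
  rw [integral_map hT.measurable.aemeasurable hf.aestronglyMeasurable]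

theorem integral_collision_snd [NeZero d] {μ : Measure (Vel d)} [IsProbabilityMeasure μ]
    {φ : Vel d → ℝ} (hφ : Measurable φ) :
    ∫ p, ‖p.1 - p.2.1‖ * φ p.2.1 ∂(collisionMeasure μ)
      = ∫ p, ‖p.1 - p.2.1‖ * φ p.1 ∂(collisionMeasure μ) := by
  rw [← integral_comp_of_measurePreserving (measurePreserving_exchange μ)
    (f := fun p : Vel d × Vel d × Sph d => ‖p.1 - p.2.1‖ * φ p.1) (by fun_prop)]
  simp only [norm_sub_rev]

theorem post_reflect (v w : Vel d) (σ : Sph d) :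
    post v w (sphereMap (LinearIsometryEquiv.neg ℝ) σ) = postStar v w σ := by
  simp [post, postStar, sphereMap, sub_eq_add_neg]

theorem norm_postStar_le (v w : Vel d) (σ : Sph d) : ‖postStar v w σ‖ ≤ ‖v‖ + ‖w‖ := by
  rw [← post_reflect]
  exact norm_post_le _ _ _

theorem integral_collision_postStar [NeZero d] {μ : Measure (Vel d)} [IsProbabilityMeasure μ]
    {φ : Vel d → ℝ} (hφ : Measurable φ) :
    ∫ p, ‖p.1 - p.2.1‖ * φ (postStar p.1 p.2.1 p.2.2) ∂(collisionMeasure μ)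
      = ∫ p, ‖p.1 - p.2.1‖ * φ (post p.1 p.2.1 p.2.2) ∂(collisionMeasure μ) := by
  have hp := (continuous_post (d := d)).measurable
  rw [← integral_comp_of_measurePreserving (measurePreserving_reflect μ)
    (f := fun p : Vel d × Vel d × Sph d => ‖p.1 - p.2.1‖ * φ (post p.1 p.2.1 p.2.2))
    (by fun_prop)]
  simp only [post_reflect]

/-- From a sphere-averaged pointwise bound to a bound on the gain term. -/
theorem gain_le_loss_add_cross [NeZero d] {μ : Measure (Vel d)} [IsProbabilityMeasure μ] {k : ℕ}
    (hk : Integrable (fun ξ : Vel d => ‖ξ‖ ^ (k + 1)) μ) {φ : Vel d → ℝ} (hφ : Measurable φ)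
    {C : ℝ} (hC : ∀ ξ, |φ ξ| ≤ C * (1 + ‖ξ‖ ^ k)) {X : Vel d → Vel d → ℝ}
    (hX : Integrable (fun p : Vel d × Vel d × Sph d => ‖p.1 - p.2.1‖ * X p.1 p.2.1)
      (collisionMeasure μ)) {ρ : ℝ}
    (hρ : ∀ v w, ∫ σ, (φ (post v w σ) + φ (postStar v w σ)) ∂(sphereMeasure d)
      ≤ ρ * (φ v + φ w + X v w)) :
    2 * ∫ p, ‖p.1 - p.2.1‖ * φ (post p.1 p.2.1 p.2.2) ∂(collisionMeasure μ)
      ≤ ρ * (2 * ∫ p, ‖p.1 - p.2.1‖ * φ p.1 ∂(collisionMeasure μ)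
        + ∫ p, ‖p.1 - p.2.1‖ * X p.1 p.2.1 ∂(collisionMeasure μ)) := by
  have i1 := integrable_collision hk hφ hC (Z := Prod.fst) measurable_fst
    (fun p => by linarith [norm_nonneg p.2.1])
  have i2 := integrable_collision hk hφ hC (Z := fun p => p.2.1) (by fun_prop)
    (fun p => by linarith [norm_nonneg p.1])
  have i3 := integrable_collision hk hφ hC continuous_post.measurable
    (fun p => norm_post_le p.1 p.2.1 p.2.2)
  have i4 := integrable_collision hk hφ hC continuous_postStar.measurable
    (fun p => norm_postStar_le p.1 p.2.1 p.2.2)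
  -- The reflection σ ↦ -σ exchanges the two outgoing particles, which makes the symmetric sum of
  -- the sphere average appear; below, the exchange of v and w does the same for the loss.
  have e1 : 2 * ∫ p, ‖p.1 - p.2.1‖ * φ (post p.1 p.2.1 p.2.2) ∂(collisionMeasure μ)
      = ∫ p, (‖p.1 - p.2.1‖ * φ (post p.1 p.2.1 p.2.2)
        + ‖p.1 - p.2.1‖ * φ (postStar p.1 p.2.1 p.2.2)) ∂(collisionMeasure μ) := by
    rw [integral_add i3 i4, integral_collision_postStar hφ]
    ring
  have e2 : ρ * (2 * ∫ p, ‖p.1 - p.2.1‖ * φ p.1 ∂(collisionMeasure μ)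
        + ∫ p, ‖p.1 - p.2.1‖ * X p.1 p.2.1 ∂(collisionMeasure μ))
      = ∫ p, ρ * (‖p.1 - p.2.1‖ * φ p.1 + ‖p.1 - p.2.1‖ * φ p.2.1
        + ‖p.1 - p.2.1‖ * X p.1 p.2.1) ∂(collisionMeasure μ) := by
    have i12 : Integrable (fun p : Vel d × Vel d × Sph d =>
        ‖p.1 - p.2.1‖ * φ p.1 + ‖p.1 - p.2.1‖ * φ p.2.1) (collisionMeasure μ) := i1.add i2
    rw [integral_const_mul, integral_add i12 hX, integral_add i1 i2,
      integral_collision_snd hφ]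
    ring
  rw [e1, e2]
  have j1 := i3.add i4
  have j2 := ((i1.add i2).add hX).const_mul ρ
  -- The hypothesis on ρ holds only after averaging in σ, so the triple is regrouped to integrate in
  -- σ first with (v, w) frozen.
  have hT := collisionMeasure_eq_map μ
  rw [← hT.integral_comp', ← hT.integral_comp']
  rw [← hT.integrable_comp_emb (MeasurableEquiv.measurableEmbedding _)] at j1 j2
  refine (integral_prod _ j1).trans_le (le_of_le_of_eq ?_ (integral_prod _ j2).symm)
  refine integral_mono j1.integral_prod_left j2.integral_prod_left fun q => ?_
  have hq := mul_le_mul_of_nonneg_left (hρ q.1 q.2) (norm_nonneg (q.1 - q.2))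
  rw [← integral_const_mul] at hq
  refine le_trans (le_of_eq ?_) (hq.trans (le_of_eq ?_))
  · refine integral_congr_ae (Eventually.of_forall fun σ => ?_)
    simp [MeasurableEquiv.prodAssoc, mul_add]
  · simp [MeasurableEquiv.prodAssoc]
    ring

/-- This is the source of coercivity: the collision frequency of a centred law is at least |ξ|, so
the loss term controls a moment one order higher. -/
theorem integral_norm_mul_le [NeZero d] {μ : Measure (Vel d)} [IsProbabilityMeasure μ]
    (h1 : Integrable (fun ξ : Vel d => ξ) μ) (h0 : ∫ ξ, ξ ∂μ = 0) {φ : Vel d → ℝ}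
    (hφ0 : ∀ ξ, 0 ≤ φ ξ)
    (h : Integrable (fun p => ‖p.1 - p.2.1‖ * φ p.1) (collisionMeasure μ)) :
    ∫ ξ, ‖ξ‖ * φ ξ ∂μ ≤ ∫ p, ‖p.1 - p.2.1‖ * φ p.1 ∂(collisionMeasure μ) := by
  rw [integral_collision_fst h]
  refine integral_mono_of_nonneg (Eventually.of_forall fun ξ => by have := hφ0 ξ; positivity)
    (integrable_collision_fst h) (Eventually.of_forall fun ξ => ?_)
  dsimp only
  rw [mul_comm]
  exact mul_le_mul_of_nonneg_left (norm_le_integral_norm_sub h1 h0 ξ) (hφ0 ξ)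

end Symmetry

/-! ### Mixed moments -/

section Cross

/-- The moment of order `n`. -/
def moment (μ : Measure (Vel d)) (n : ℕ) : ℝ := ∫ ξ, ‖ξ‖ ^ n ∂μ

theorem moment_nonneg (μ : Measure (Vel d)) (n : ℕ) : 0 ≤ moment μ n :=
  integral_nonneg fun _ => by positivity

/-- The products of moments that bound the mixed part of a collision moment of order `2(n+1)`. -/
def crossSum (μ : Measure (Vel d)) (n : ℕ) : ℝ :=
  ∑ i ∈ Finset.range n, ((n + 1).choose (i + 1) : ℝ) * (moment μ (2 * i + 3) * moment μ (2 * (n - i)))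

theorem integrable_collision_pow_mul [NeZero d] {μ : Measure (Vel d)} [IsProbabilityMeasure μ]
    {i j : ℕ} (hi : Integrable (fun ξ : Vel d => ‖ξ‖ ^ i) μ)
    (hj : Integrable (fun ξ : Vel d => ‖ξ‖ ^ j) μ) :
    Integrable (fun p : Vel d × Vel d × Sph d => ‖p.1‖ ^ i * ‖p.2.1‖ ^ j) (collisionMeasure μ) :=
  hi.mul_prod (hj.comp_fst (sphereMeasure d))

theorem integral_collision_pow_mul [NeZero d] {μ : Measure (Vel d)} [IsProbabilityMeasure μ]
    (i j : ℕ) :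
    ∫ p : Vel d × Vel d × Sph d, ‖p.1‖ ^ i * ‖p.2.1‖ ^ j ∂(collisionMeasure μ)
      = moment μ i * moment μ j := by
  rw [collisionMeasure, integral_prod_mul (fun v : Vel d => ‖v‖ ^ i)
    (fun q : Vel d × Sph d => ‖q.1‖ ^ j), integral_fun_fst (fun w : Vel d => ‖w‖ ^ j)]
  simp [moment]

theorem add_pow_sub_pow_sub_pow (x y : ℝ) (n : ℕ) :
    (x + y) ^ (n + 1) - x ^ (n + 1) - y ^ (n + 1)
      = ∑ i ∈ Finset.range n, ((n + 1).choose (i + 1) : ℝ) * (x ^ (i + 1) * y ^ (n - i)) := by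
  rw [add_pow, Finset.sum_range_succ, Finset.sum_range_succ']
  have : ∀ i ∈ Finset.range n, x ^ (i + 1) * y ^ (n + 1 - (i + 1)) * ((n + 1).choose (i + 1) : ℝ)
      = ((n + 1).choose (i + 1) : ℝ) * (x ^ (i + 1) * y ^ (n - i)) := by
    intro i hi
    rw [Nat.add_sub_add_right]; ring
  rw [Finset.sum_congr rfl this]
  simp

theorem sum_choose_reflect (f : ℕ → ℕ → ℝ) (n : ℕ) :
    ∑ i ∈ Finset.range n, ((n + 1).choose (i + 1) : ℝ) * f (i + 1) (n - i)
      = ∑ i ∈ Finset.range n, ((n + 1).choose (i + 1) : ℝ) * f (n - i) (i + 1) := by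
  rw [← Finset.sum_range_reflect]
  refine Finset.sum_congr rfl fun i hi => ?_
  have hi := Finset.mem_range.1 hi
  have e1 : n - 1 - i + 1 = n - i := by omega
  have e2 : n - (n - 1 - i) = i + 1 := by omega
  have e3 : (n + 1).choose (n - i) = (n + 1).choose (i + 1) := by
    rw [← Nat.choose_symm (by omega)]; congr 1; omega
  rw [e1, e2, e3]

/-- The mixed part of the collision moment of order `2(n+1)`. -/
def crossTerm (n : ℕ) (v w : Vel d) : ℝ :=
  (‖v‖ ^ 2 + ‖w‖ ^ 2) ^ (n + 1) - (‖v‖ ^ 2) ^ (n + 1) - (‖w‖ ^ 2) ^ (n + 1)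

/-- With |v - w| ≤ |v| + |w|, every monomial of the cross term splits into two products of powers of
|v| and |w|, each power of order at most 2n + 1 although the total order is 2n + 3. Reflecting the
summation index identifies the two families, whence the factor 2. -/
theorem integral_crossTerm_le [NeZero d] {μ : Measure (Vel d)} [IsProbabilityMeasure μ] {n : ℕ}
    (hn : Integrable (fun ξ : Vel d => ‖ξ‖ ^ (2 * n + 1)) μ) :
    Integrable (fun p : Vel d × Vel d × Sph d => ‖p.1 - p.2.1‖ * crossTerm n p.1 p.2.1)
      (collisionMeasure μ) ∧
    ∫ p, ‖p.1 - p.2.1‖ * crossTerm n p.1 p.2.1 ∂(collisionMeasure μ) ≤ 2 * crossSum μ n := by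
  set F : Vel d × Vel d × Sph d → ℝ := fun p => ∑ i ∈ Finset.range n,
    ((n + 1).choose (i + 1) : ℝ) * (‖p.1‖ ^ (2 * i + 3) * ‖p.2.1‖ ^ (2 * (n - i))
      + ‖p.1‖ ^ (2 * (i + 1)) * ‖p.2.1‖ ^ (2 * (n - i) + 1)) with hF
  have hint : ∀ i ∈ Finset.range n,
      Integrable (fun p : Vel d × Vel d × Sph d => ‖p.1‖ ^ (2 * i + 3) * ‖p.2.1‖ ^ (2 * (n - i)))
        (collisionMeasure μ) ∧
      Integrable (fun p : Vel d × Vel d × Sph d =>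
        ‖p.1‖ ^ (2 * (i + 1)) * ‖p.2.1‖ ^ (2 * (n - i) + 1)) (collisionMeasure μ) := by
    intro i hi
    have hi := Finset.mem_range.1 hi
    exact ⟨integrable_collision_pow_mul (integrable_norm_pow_of_le hn (by omega))
        (integrable_norm_pow_of_le hn (by omega)),
      integrable_collision_pow_mul (integrable_norm_pow_of_le hn (by omega))
        (integrable_norm_pow_of_le hn (by omega))⟩
  have hFint : Integrable F (collisionMeasure μ) :=
    integrable_finsetSum _ fun i hi => ((hint i hi).1.add (hint i hi).2).const_mul _
  have hcross : ∀ v w : Vel d, crossTerm n v w = ∑ i ∈ Finset.range n,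
      ((n + 1).choose (i + 1) : ℝ) * ((‖v‖ ^ 2) ^ (i + 1) * (‖w‖ ^ 2) ^ (n - i)) := fun v w =>
    add_pow_sub_pow_sub_pow _ _ _
  have hcross0 : ∀ v w : Vel d, 0 ≤ crossTerm n v w := fun v w => by
    rw [hcross]; positivity
  have hle : ∀ p : Vel d × Vel d × Sph d, ‖p.1 - p.2.1‖ * crossTerm n p.1 p.2.1 ≤ F p := by
    intro p
    calc _ ≤ (‖p.1‖ + ‖p.2.1‖) * crossTerm n p.1 p.2.1 :=
          mul_le_mul_of_nonneg_right (norm_sub_le _ _) (hcross0 _ _)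
      _ = F p := by
          rw [hcross, Finset.mul_sum, hF]
          refine Finset.sum_congr rfl fun i _ => ?_
          rw [← pow_mul, ← pow_mul]
          ring
  have hmeas : Measurable fun p : Vel d × Vel d × Sph d =>
      ‖p.1 - p.2.1‖ * crossTerm n p.1 p.2.1 := by
    unfold crossTerm; fun_prop
  have hI : Integrable (fun p : Vel d × Vel d × Sph d => ‖p.1 - p.2.1‖ * crossTerm n p.1 p.2.1)
      (collisionMeasure μ) := by
    refine hFint.mono' hmeas.aestronglyMeasurable (Eventually.of_forall fun p => ?_)
    rw [Real.norm_of_nonneg (mul_nonneg (norm_nonneg _) (hcross0 _ _))]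
    exact hle p
  refine ⟨hI, (integral_mono hI hFint hle).trans (le_of_eq ?_)⟩
  refine (integral_finsetSum _ fun i hi =>
    ((hint i hi).1.add (hint i hi).2).const_mul ((n + 1).choose (i + 1) : ℝ)).trans ?_
  simp only [Pi.add_apply]
  have e1 : ∀ i ∈ Finset.range n, ∫ p : Vel d × Vel d × Sph d, ((n + 1).choose (i + 1) : ℝ) *
      (‖p.1‖ ^ (2 * i + 3) * ‖p.2.1‖ ^ (2 * (n - i))
      + ‖p.1‖ ^ (2 * (i + 1)) * ‖p.2.1‖ ^ (2 * (n - i) + 1)) ∂(collisionMeasure μ)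
      = ((n + 1).choose (i + 1) : ℝ) * (moment μ (2 * i + 3) * moment μ (2 * (n - i)))
        + ((n + 1).choose (i + 1) : ℝ) * (moment μ (2 * (i + 1)) * moment μ (2 * (n - i) + 1)) := by
    intro i hi
    rw [integral_const_mul, integral_add (hint i hi).1 (hint i hi).2,
      integral_collision_pow_mul, integral_collision_pow_mul, mul_add]
  rw [Finset.sum_congr rfl e1, Finset.sum_add_distrib,
    sum_choose_reflect (fun a b => moment μ (2 * a) * moment μ (2 * b + 1)), two_mul, crossSum]
  congr 1
  refine Finset.sum_congr rfl fun i _ => ?_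
  rw [mul_comm (moment μ (2 * (n - i)))]
  ring_nf

end Cross

/-! ### Radial test functions and truncated powers -/

theorem fderiv_radial {g : ℝ → ℝ} {g' : ℝ} (ξ : Vel d) (h : HasDerivAt g g' (‖ξ‖ ^ 2)) :
    fderiv ℝ (fun η : Vel d => g (‖η‖ ^ 2)) ξ ξ = 2 * ‖ξ‖ ^ 2 * g' := by
  have h1 : HasFDerivAt (fun η : Vel d => ‖η‖ ^ 2) (2 • innerSL ℝ ξ) ξ :=
    (hasStrictFDerivAt_norm_sq ξ).hasFDerivAt
  have h2 : HasFDerivAt (fun η : Vel d => g (‖η‖ ^ 2)) (g' • (2 • innerSL ℝ ξ)) ξ :=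
    h.comp_hasFDerivAt ξ h1
  rw [h2.fderiv]
  simp
  ring

section Truncation

/-- The bounded concave increasing truncation `x / (1 + εx)`. -/
def trunc (ε x : ℝ) : ℝ := x / (1 + ε * x)

variable {ε x y : ℝ}

theorem trunc_nonneg (hε : 0 < ε) (hx : 0 ≤ x) : 0 ≤ trunc ε x := by
  unfold trunc; positivity

theorem trunc_le (hε : 0 < ε) (hx : 0 ≤ x) : trunc ε x ≤ x :=
  div_le_self hx (by nlinarith [mul_nonneg hε.le hx])

theorem trunc_le_inv (hε : 0 < ε) (hx : 0 ≤ x) : trunc ε x ≤ ε⁻¹ := by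
  unfold trunc
  rw [div_le_iff₀ (by positivity)]
  field_simp
  linarith

theorem trunc_mono (hε : 0 < ε) (hx : 0 ≤ x) (hxy : x ≤ y) : trunc ε x ≤ trunc ε y := by
  have hy := hx.trans hxy
  unfold trunc
  rw [div_le_div_iff₀ (by positivity) (by positivity)]
  nlinarith

theorem trunc_add_le (hε : 0 < ε) (hx : 0 ≤ x) (hy : 0 ≤ y) :
    trunc ε (x + y) ≤ trunc ε x + trunc ε y := by
  have h1 : x / (1 + ε * (x + y)) ≤ x / (1 + ε * x) := by
    gcongr; linarith
  have h2 : y / (1 + ε * (x + y)) ≤ y / (1 + ε * y) := by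
    gcongr; linarith
  unfold trunc
  rw [add_div]
  exact add_le_add h1 h2

theorem add_pow_sub_pow_mono {a b a' b' : ℝ} (ha : 0 ≤ a) (hb : 0 ≤ b) (haa : a ≤ a')
    (hbb : b ≤ b') (n : ℕ) : (a + b) ^ n - a ^ n ≤ (a' + b') ^ n - a' ^ n := by
  induction n with
  | zero => simp
  | succ n ih =>
    have h0 : 0 ≤ (a + b) ^ n - a ^ n := by
      rw [sub_nonneg]; gcongr; linarith
    have h1 : a * ((a + b) ^ n - a ^ n) ≤ a' * ((a' + b') ^ n - a' ^ n) :=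
      mul_le_mul haa ih h0 (ha.trans haa)
    have h2 : b * (a + b) ^ n ≤ b' * (a' + b') ^ n := by
      have := hb.trans hbb
      gcongr
    calc _ = a * ((a + b) ^ n - a ^ n) + b * (a + b) ^ n := by ring
      _ ≤ a' * ((a' + b') ^ n - a' ^ n) + b' * (a' + b') ^ n := add_le_add h1 h2
      _ = _ := by ring

/-- The truncation of `x^{n+1}`. -/
def truncPow (ε : ℝ) (n : ℕ) (x : ℝ) : ℝ := x * trunc ε x ^ n

theorem truncPow_nonneg (hε : 0 < ε) (n : ℕ) (hx : 0 ≤ x) : 0 ≤ truncPow ε n x :=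
  mul_nonneg hx (pow_nonneg (trunc_nonneg hε hx) n)

theorem truncPow_le_pow (hε : 0 < ε) (n : ℕ) (hx : 0 ≤ x) : truncPow ε n x ≤ x ^ (n + 1) := by
  have h := pow_le_pow_left₀ (trunc_nonneg hε hx) (trunc_le hε hx) n
  calc x * trunc ε x ^ n ≤ x * x ^ n := by gcongr
    _ = _ := by ring

theorem truncPow_le_mul (hε : 0 < ε) (n : ℕ) (hx : 0 ≤ x) :
    truncPow ε n x ≤ (ε⁻¹) ^ n * x := by
  have h := pow_le_pow_left₀ (trunc_nonneg hε hx) (trunc_le_inv hε hx) n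
  calc x * trunc ε x ^ n ≤ x * (ε⁻¹) ^ n := by gcongr
    _ = _ := by ring

/-- x times an increasing function of x is superadditive. Energy conservation turns this into a
Povzner bound with constant 1, without angular averaging. -/
theorem truncPow_split_le (hε : 0 < ε) (n : ℕ) {s t : ℝ} (hs : 0 ≤ s) (ht : 0 ≤ t) :
    truncPow ε n s + truncPow ε n t ≤ truncPow ε n (s + t) := by
  have h1 := pow_le_pow_left₀ (trunc_nonneg hε hs)
    (trunc_mono hε hs (by linarith : s ≤ s + t)) n
  have h2 := pow_le_pow_left₀ (trunc_nonneg hε ht)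
    (trunc_mono hε ht (by linarith : t ≤ s + t)) n
  unfold truncPow
  rw [add_mul]
  gcongr

/-- The truncation is subadditive and lies below the identity, and (a+b)^n - a^n is monotone in a
and b; hence the mixed part is dominated by that of the untruncated power, uniformly in ε. -/
theorem truncPow_add_le (hε : 0 < ε) (n : ℕ) (hx : 0 ≤ x) (hy : 0 ≤ y) :
    truncPow ε n (x + y) ≤ truncPow ε n x + truncPow ε n y
      + ((x + y) ^ (n + 1) - x ^ (n + 1) - y ^ (n + 1)) := by
  have hx' := trunc_nonneg hε hx
  have hy' := trunc_nonneg hε hy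
  have h0 : trunc ε (x + y) ^ n ≤ (trunc ε x + trunc ε y) ^ n :=
    pow_le_pow_left₀ (trunc_nonneg hε (by linarith)) (trunc_add_le hε hx hy) n
  have h1 := add_pow_sub_pow_mono hx' hy' (trunc_le hε hx) (trunc_le hε hy) n
  have h2 := add_pow_sub_pow_mono hy' hx' (trunc_le hε hy) (trunc_le hε hx) n
  rw [add_comm (trunc ε y), add_comm y] at h2
  have h3 : x * trunc ε (x + y) ^ n ≤ x * (trunc ε x ^ n + ((x + y) ^ n - x ^ n)) := by
    gcongr; linarith
  have h4 : y * trunc ε (x + y) ^ n ≤ y * (trunc ε y ^ n + ((x + y) ^ n - y ^ n)) := by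
    gcongr; linarith
  unfold truncPow
  calc _ = x * trunc ε (x + y) ^ n + y * trunc ε (x + y) ^ n := by ring
    _ ≤ _ := add_le_add h3 h4
    _ = _ := by ring

theorem hasDerivAt_truncPow (hε : 0 < ε) (n : ℕ) (hx : 0 ≤ x) :
    HasDerivAt (truncPow ε n)
      (trunc ε x ^ n + x * (n * trunc ε x ^ (n - 1) * (1 / (1 + ε * x) ^ 2))) x := by
  have hne : 1 + ε * x ≠ 0 := by positivity
  have h1 : HasDerivAt (trunc ε) (1 / (1 + ε * x) ^ 2) x := by
    refine ((hasDerivAt_id' x).fun_div (((hasDerivAt_id' x).const_mul ε).const_add 1)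
      hne).congr_deriv ?_
    field_simp
    ring
  exact ((hasDerivAt_id' x).fun_mul (h1.fun_pow n)).congr_deriv (by ring)

/-- The Euler relation for x^{n+1} survives truncation as an inequality; it lets the drift term be
bounded by the test function itself. -/
theorem mul_deriv_truncPow_mem (hε : 0 < ε) (n : ℕ) (hx : 0 ≤ x) :
    0 ≤ x * (trunc ε x ^ n + x * (n * trunc ε x ^ (n - 1) * (1 / (1 + ε * x) ^ 2))) ∧
    x * (trunc ε x ^ n + x * (n * trunc ε x ^ (n - 1) * (1 / (1 + ε * x) ^ 2)))
      ≤ (n + 1) * truncPow ε n x := by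
  have ht := trunc_nonneg hε hx
  refine ⟨by positivity, ?_⟩
  have hd : 1 ≤ 1 + ε * x := by nlinarith [mul_nonneg hε.le hx]
  have key : x * (n * trunc ε x ^ (n - 1) * (1 / (1 + ε * x) ^ 2)) ≤ n * trunc ε x ^ n := by
    rcases n with _ | n
    · simp
    · have e : x * (((n + 1 : ℕ) : ℝ) * trunc ε x ^ (n + 1 - 1) * (1 / (1 + ε * x) ^ 2))
          = ((n + 1 : ℕ) : ℝ) * (trunc ε x ^ (n + 1) * (1 / (1 + ε * x))) := by
        rw [Nat.add_sub_cancel, pow_succ (trunc ε x) n]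
        have ht' : trunc ε x = x * (1 / (1 + ε * x)) := by rw [trunc]; ring
        generalize trunc ε x ^ n = T
        rw [ht']
        field_simp
      rw [e]
      refine mul_le_mul_of_nonneg_left ?_ (by positivity)
      exact mul_le_of_le_one_right (by positivity) (div_le_one_of_le₀ hd (by positivity))
  calc _ ≤ x * (trunc ε x ^ n + n * trunc ε x ^ n) := by gcongr
    _ = _ := by unfold truncPow; ring

theorem tendsto_truncPow (n : ℕ) (x : ℝ) :
    Tendsto (fun k : ℕ => truncPow (1 / ((k : ℝ) + 1)) n x) atTop (𝓝 (x ^ (n + 1))) := by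
  have h0 := tendsto_one_div_add_atTop_nhds_zero_nat (𝕜 := ℝ)
  have hc : ContinuousAt (fun ε : ℝ => truncPow ε n x) 0 := by
    unfold truncPow trunc
    refine continuousAt_const.mul ((continuousAt_const.div (by fun_prop) (by simp)).pow n)
  have := hc.tendsto.comp h0
  have e : truncPow 0 n x = x ^ (n + 1) := by simp [truncPow, trunc]; ring
  rwa [e] at this

theorem contDiff_truncPow (hε : 0 < ε) (n : ℕ) :
    ContDiff ℝ ∞ fun ξ : Vel d => truncPow ε n (‖ξ‖ ^ 2) := by
  have h := contDiff_norm_sq ℝ (E := Vel d) (n := ∞)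
  unfold truncPow trunc
  exact h.mul ((h.div (contDiff_const.add (contDiff_const.mul h)) fun ξ => by positivity).pow n)

end Truncation

/-! ### Finiteness of all moments -/

variable {α : ℝ} {μ : Measure (Vel d)}

theorem IsProfileLaw.integrable_id [IsProbabilityMeasure μ] (h : IsProfileLaw α μ) :
    Integrable (fun ξ : Vel d => ξ) μ := by
  have i1 : Integrable (fun ξ : Vel d => ‖ξ‖) μ := by
    simpa using integrable_norm_pow_of_le h.integrable (k := 1) (by omega)
  exact (integrable_norm_iff (by fun_prop)).1 i1

theorem collisionRate_nonneg : 0 ≤ collisionRate μ := integral_nonneg fun _ => norm_nonneg _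

theorem collisionEnergy_nonneg : 0 ≤ collisionEnergy μ :=
  integral_nonneg fun _ => by positivity

/-- The moment estimate for the truncated power, with a bound independent of the truncation. -/
theorem IsProfileLaw.truncated_moment_le [NeZero d] [IsProbabilityMeasure μ]
    (h : IsProfileLaw α μ) (hα : 0 < α) (hα1 : α ≤ 1) {n : ℕ}
    (hn : Integrable (fun ξ : Vel d => ‖ξ‖ ^ (2 * n + 1)) μ) :
    ∃ M : ℝ, ∀ ε : ℝ, 0 < ε →
      Integrable (fun ξ : Vel d => ‖ξ‖ * truncPow ε n (‖ξ‖ ^ 2)) μ ∧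
      ∫ ξ, ‖ξ‖ * truncPow ε n (‖ξ‖ ^ 2) ∂μ ≤ M := by
  -- K bounds the total coefficient of ∫ φ dμ, the drift included since |ξ·∇φ| ≤ 2(n+1) φ.
  set K := α * collisionRate μ + |driftCoeff α μ| * (2 * (n + 1)) with hK
  have hK0 : 0 ≤ K := by have := collisionRate_nonneg (μ := μ); positivity
  refine ⟨(crossSum μ n + K * (2 * K / α) ^ (2 * n + 2)) * (2 / α), fun ε hε => ?_⟩
  set φ : Vel d → ℝ := fun ξ => truncPow ε n (‖ξ‖ ^ 2) with hφ
  set D : Vel d → ℝ := fun ξ => fderiv ℝ φ ξ ξ with hD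
  have hsm : ContDiff ℝ ∞ φ := contDiff_truncPow hε n
  have hφm : Measurable φ := hsm.continuous.measurable
  have hDm : Measurable D :=
    ((hsm.continuous_fderiv (by simp)).clm_apply continuous_id).measurable
  have hφ0 : ∀ ξ, 0 ≤ φ ξ := fun ξ => truncPow_nonneg hε n (by positivity)
  have hDle : ∀ ξ, |D ξ| ≤ 2 * (n + 1) * φ ξ := by
    intro ξ
    obtain ⟨k0, k1⟩ := mul_deriv_truncPow_mem hε n (sq_nonneg ‖ξ‖)
    have e := fderiv_radial ξ (hasDerivAt_truncPow hε n (sq_nonneg ‖ξ‖))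
    rw [mul_assoc] at e
    simp only [hD, hφ]
    rw [e, abs_of_nonneg (by linarith)]
    linarith
  have hgrow : ∀ ξ, φ ξ ≤ (ε⁻¹) ^ n * (1 + ‖ξ‖ ^ 2) := fun ξ =>
    (truncPow_le_mul hε n (sq_nonneg ‖ξ‖)).trans (by gcongr; linarith)
  set C := 2 * (n + 1) * (ε⁻¹) ^ n with hCdef
  have hCn : (ε⁻¹) ^ n ≤ C := by
    have : 0 ≤ (ε⁻¹) ^ n := by positivity
    rw [hCdef]
    nlinarith [mul_nonneg (Nat.cast_nonneg (α := ℝ) n) this]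
  have hC : ∀ ξ, |φ ξ| ≤ C * (1 + ‖ξ‖ ^ 2) := fun ξ => by
    rw [abs_of_nonneg (hφ0 ξ)]
    exact (hgrow ξ).trans (by gcongr)
  have hCD : ∀ ξ, |D ξ| ≤ C * (1 + ‖ξ‖ ^ 2) := fun ξ =>
    (hDle ξ).trans (by
      rw [hCdef, mul_assoc (2 * ((n : ℝ) + 1))]
      exact mul_le_mul_of_nonneg_left (hgrow ξ) (by positivity))
  have i2 := integrable_norm_pow_of_le h.integrable (k := 2) (by omega)
  have iφ : Integrable φ μ := integrable_growth i2 hφm hC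
  have iD : Integrable D μ := integrable_growth i2 hDm hCD
  have hweak := WeakIdentity.of_growth h.weak (k := 2) h.integrable hsm hC hCD
  obtain ⟨iX, hX⟩ := integral_crossTerm_le hn
  -- The constant ρ = 1 suffices: the factor 1 - α before the gain leaves a surplus αL of loss.
  have hgain := gain_le_loss_add_cross (k := 2) h.integrable hφm hC iX (ρ := 1) (fun v w => by
    calc ∫ σ, (φ (post v w σ) + φ (postStar v w σ)) ∂(sphereMeasure d)
        ≤ ∫ _ : Sph d, truncPow ε n (‖v‖ ^ 2 + ‖w‖ ^ 2) ∂(sphereMeasure d) := by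
          refine integral_mono_of_nonneg
            (Eventually.of_forall fun σ => add_nonneg (hφ0 _) (hφ0 _)) (integrable_const _)
            (Eventually.of_forall fun σ => ?_)
          have := truncPow_split_le hε n (sq_nonneg ‖post v w σ‖) (sq_nonneg ‖postStar v w σ‖)
          rwa [norm_post_sq_add_norm_postStar_sq] at this
      _ = truncPow ε n (‖v‖ ^ 2 + ‖w‖ ^ 2) := by simp
      _ ≤ _ := by
          rw [one_mul]
          exact truncPow_add_le hε n (sq_nonneg _) (sq_nonneg _))
  have iL := integrable_collision h.integrable hφm hC (Z := Prod.fst) measurable_fst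
    (fun p => by linarith [norm_nonneg p.2.1])
  have hL := integral_norm_mul_le h.integrable_id h.momentum hφ0 iL
  have irφ : Integrable (fun ξ => ‖ξ‖ * φ ξ) μ := by
    refine (h.integrable.const_mul ((ε⁻¹) ^ n)).mono' (by fun_prop)
      (Eventually.of_forall fun ξ => ?_)
    rw [Real.norm_of_nonneg (mul_nonneg (norm_nonneg _) (hφ0 ξ))]
    calc ‖ξ‖ * φ ξ ≤ ‖ξ‖ * ((ε⁻¹) ^ n * ‖ξ‖ ^ 2) :=
          mul_le_mul_of_nonneg_left (truncPow_le_mul hε n (sq_nonneg ‖ξ‖)) (norm_nonneg _)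
      _ = _ := by ring
  refine ⟨irφ, ?_⟩
  set L := ∫ p, ‖p.1 - p.2.1‖ * φ p.1 ∂(collisionMeasure μ) with hLdef
  set G := ∫ p, ‖p.1 - p.2.1‖ * φ (post p.1 p.2.1 p.2.2) ∂(collisionMeasure μ) with hG
  have hid : L = (1 - α) * G + α * collisionRate μ * ∫ ξ, φ ξ ∂μ
      + driftCoeff α μ * ∫ ξ, D ξ ∂μ := hweak
  have hdrift : driftCoeff α μ * ∫ ξ, D ξ ∂μ
      ≤ |driftCoeff α μ| * (2 * (n + 1)) * ∫ ξ, φ ξ ∂μ := by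
    calc _ ≤ |driftCoeff α μ| * |∫ ξ, D ξ ∂μ| := by rw [← abs_mul]; exact le_abs_self _
      _ ≤ |driftCoeff α μ| * ∫ ξ, 2 * (n + 1) * φ ξ ∂μ := by
          gcongr
          exact (abs_integral_le_integral_abs).trans
            (integral_mono iD.abs (iφ.const_mul _) hDle)
      _ = _ := by rw [integral_const_mul]; ring
  have hyoung : K * ∫ ξ, φ ξ ∂μ ≤ α / 2 * ∫ ξ, ‖ξ‖ * φ ξ ∂μ
      + K * (2 * K / α) ^ (2 * n + 2) := by
    calc K * ∫ ξ, φ ξ ∂μ = ∫ ξ, K * φ ξ ∂μ := (integral_const_mul _ _).symm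
      _ ≤ ∫ ξ, (α / 2 * (‖ξ‖ * φ ξ) + K * (2 * K / α) ^ (2 * n + 2)) ∂μ := by
          refine integral_mono (iφ.const_mul _) ((irφ.const_mul _).add (integrable_const _))
            fun ξ => ?_
          dsimp only
          -- Beyond radius 2K/α half of the surplus α|ξ| dominates K; inside, φ is at most the
          -- untruncated power of that radius.
          rcases le_total (2 * K / α) ‖ξ‖ with hc | hc
          · have h1 : K ≤ α / 2 * ‖ξ‖ := by
              rw [div_le_iff₀ hα] at hc; linarith
            have h2 := mul_le_mul_of_nonneg_right h1 (hφ0 ξ)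
            have h3 : 0 ≤ K * (2 * K / α) ^ (2 * n + 2) := by positivity
            linarith
          · have h1 : φ ξ ≤ (2 * K / α) ^ (2 * n + 2) := by
              refine (truncPow_le_pow hε n (sq_nonneg ‖ξ‖)).trans ?_
              rw [← pow_mul]
              exact pow_le_pow_left₀ (norm_nonneg _) hc _
            have h2 := mul_le_mul_of_nonneg_left h1 hK0
            have h3 : 0 ≤ α / 2 * (‖ξ‖ * φ ξ) :=
              mul_nonneg (by positivity) (mul_nonneg (norm_nonneg _) (hφ0 ξ))
            linarith
      _ = _ := by
          rw [integral_add (irφ.const_mul _) (integrable_const _), integral_const_mul]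
          simp
  have hc0 : 0 ≤ crossSum μ n := Finset.sum_nonneg fun i _ =>
    mul_nonneg (Nat.cast_nonneg _) (mul_nonneg (moment_nonneg _ _) (moment_nonneg _ _))
  have hG' : G ≤ L + crossSum μ n := by linarith
  have h5 : (1 - α) * G ≤ (1 - α) * (L + crossSum μ n) :=
    mul_le_mul_of_nonneg_left hG' (by linarith)
  have h6 : (1 - α) * crossSum μ n ≤ crossSum μ n :=
    mul_le_of_le_one_left hc0 (by linarith)
  have h7 : α * L ≤ crossSum μ n + K * ∫ ξ, φ ξ ∂μ := by
    rw [hK]; linarith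
  have h8 : α / 2 * ∫ ξ, ‖ξ‖ * φ ξ ∂μ ≤ crossSum μ n + K * (2 * K / α) ^ (2 * n + 2) := by
    have := mul_le_mul_of_nonneg_left hL hα.le
    linarith
  rw [mul_div_assoc', le_div_iff₀ hα]
  linarith

/-- Gain of two moments. -/
theorem IsProfileLaw.integrable_succ [NeZero d] [IsProbabilityMeasure μ]
    (h : IsProfileLaw α μ) (hα : 0 < α) (hα1 : α ≤ 1) {n : ℕ}
    (hn : Integrable (fun ξ : Vel d => ‖ξ‖ ^ (2 * n + 1)) μ) :
    Integrable (fun ξ : Vel d => ‖ξ‖ ^ (2 * (n + 1) + 1)) μ := by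
  obtain ⟨M, hM⟩ := h.truncated_moment_le hα hα1 hn
  have hε : ∀ k : ℕ, (0 : ℝ) < 1 / ((k : ℝ) + 1) := fun k => by positivity
  set f : ℕ → Vel d → ℝ := fun k ξ => ‖ξ‖ * truncPow (1 / ((k : ℝ) + 1)) n (‖ξ‖ ^ 2) with hf
  have hf0 : ∀ k ξ, 0 ≤ f k ξ := fun k ξ =>
    mul_nonneg (norm_nonneg _) (truncPow_nonneg (hε k) n (by positivity))
  have hlim : ∀ ξ : Vel d, Tendsto (fun k => f k ξ) atTop (𝓝 (‖ξ‖ ^ (2 * (n + 1) + 1))) := by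
    intro ξ
    have := (tendsto_truncPow n (‖ξ‖ ^ 2)).const_mul ‖ξ‖
    rw [← pow_mul] at this
    rwa [pow_succ' ‖ξ‖ (2 * (n + 1))]
  have hfm : ∀ k, Measurable (f k) := fun k =>
    measurable_norm.mul (contDiff_truncPow (hε k) n).continuous.measurable
  refine ⟨by fun_prop, ?_⟩
  rw [hasFiniteIntegral_iff_ofReal (Eventually.of_forall fun ξ => by positivity)]
  -- Fatou's lemma as ε → 0, by the bound M independent of ε.
  calc ∫⁻ ξ, ENNReal.ofReal (‖ξ‖ ^ (2 * (n + 1) + 1)) ∂μ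
      = ∫⁻ ξ, liminf (fun k => ENNReal.ofReal (f k ξ)) atTop ∂μ := by
        refine lintegral_congr fun ξ => ?_
        exact ((ENNReal.continuous_ofReal.tendsto _).comp (hlim ξ)).liminf_eq.symm
    _ ≤ liminf (fun k => ∫⁻ ξ, ENNReal.ofReal (f k ξ) ∂μ) atTop :=
        lintegral_liminf_le fun k => (hfm k).ennreal_ofReal
    _ ≤ liminf (fun _ : ℕ => ENNReal.ofReal M) atTop := by
        refine liminf_le_liminf (Eventually.of_forall fun k => ?_)
        obtain ⟨hi, hle⟩ := hM _ (hε k)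
        rw [← ofReal_integral_eq_lintegral_ofReal hi (Eventually.of_forall (hf0 k))]
        exact ENNReal.ofReal_le_ofReal hle
    _ < ⊤ := by simp

theorem IsProfileLaw.integrable_pow [NeZero d] [IsProbabilityMeasure μ]
    (h : IsProfileLaw α μ) (hα : 0 < α) (hα1 : α ≤ 1) (k : ℕ) :
    Integrable (fun ξ : Vel d => ‖ξ‖ ^ k) μ := by
  have hodd : ∀ n : ℕ, Integrable (fun ξ : Vel d => ‖ξ‖ ^ (2 * (n + 1) + 1)) μ := by
    intro n
    induction n with
    | zero => exact h.integrable
    | succ n ih => exact h.integrable_succ hα hα1 ih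
  exact integrable_norm_pow_of_le (hodd k) (by omega)

/-! ### Moment inequalities uniform in α -/

theorem collisionEnergy_le [NeZero d] [IsProbabilityMeasure μ]
    (h3 : Integrable (fun ξ : Vel d => ‖ξ‖ ^ 3) μ) :
    collisionEnergy μ ≤ moment μ 3 + moment μ 2 * moment μ 1 := by
  have i : ∀ {k : ℕ}, k ≤ 3 → Integrable (fun ξ : Vel d => ‖ξ‖ ^ k) μ := fun hk =>
    integrable_norm_pow_of_le h3 hk
  have j1 := integrable_collision_pow_mul (μ := μ) (i (le_refl 3)) (i (Nat.zero_le 3))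
  have j2 := integrable_collision_pow_mul (μ := μ) (i (by omega : 2 ≤ 3)) (i (by omega : 1 ≤ 3))
  have e : moment μ 3 + moment μ 2 * moment μ 1 = ∫ p : Vel d × Vel d × Sph d,
      (‖p.1‖ ^ 3 * ‖p.2.1‖ ^ 0 + ‖p.1‖ ^ 2 * ‖p.2.1‖ ^ 1) ∂(collisionMeasure μ) := by
    rw [integral_add j1 j2, integral_collision_pow_mul, integral_collision_pow_mul]
    simp [moment]
  rw [e]
  refine integral_mono_of_nonneg (Eventually.of_forall fun p => by positivity) (j1.add j2)
    (Eventually.of_forall fun p => ?_)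
  calc ‖p.1 - p.2.1‖ * ‖p.1‖ ^ 2 ≤ (‖p.1‖ + ‖p.2.1‖) * ‖p.1‖ ^ 2 := by
        gcongr; exact norm_sub_le _ _
    _ = _ := by simp; ring

/-- Cauchy-Schwarz, from the nonnegative integral of (t|ξ| - |ξ|²)² at the optimal t. -/
theorem moment_three_sq_le [IsProbabilityMeasure μ]
    (h4 : Integrable (fun ξ : Vel d => ‖ξ‖ ^ 4) μ) (h2 : 0 < moment μ 2) :
    moment μ 3 ^ 2 ≤ moment μ 2 * moment μ 4 := by
  have i2 := integrable_norm_pow_of_le h4 (k := 2) (by omega)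
  have i3 := integrable_norm_pow_of_le h4 (k := 3) (by omega)
  set t := moment μ 3 / moment μ 2 with ht
  have h : 0 ≤ ∫ ξ, (t ^ 2 * ‖ξ‖ ^ 2 - 2 * t * ‖ξ‖ ^ 3 + ‖ξ‖ ^ 4) ∂μ :=
    integral_nonneg fun ξ => by
      have := sq_nonneg (t * ‖ξ‖ - ‖ξ‖ ^ 2)
      change (0 : ℝ) ≤ t ^ 2 * ‖ξ‖ ^ 2 - 2 * t * ‖ξ‖ ^ 3 + ‖ξ‖ ^ 4
      nlinarith
  have j : Integrable (fun ξ : Vel d => t ^ 2 * ‖ξ‖ ^ 2 - 2 * t * ‖ξ‖ ^ 3) μ :=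
    (i2.const_mul _).sub (i3.const_mul _)
  rw [integral_add j h4, integral_sub (i2.const_mul _) (i3.const_mul _), integral_const_mul,
    integral_const_mul] at h
  change 0 ≤ t ^ 2 * moment μ 2 - 2 * t * moment μ 3 + moment μ 4 at h
  have e : t * moment μ 2 = moment μ 3 := div_mul_cancel₀ _ h2.ne'
  have e2 : t ^ 2 * moment μ 2 = t * moment μ 3 := by rw [← e]; ring
  have h5 : t * moment μ 3 ≤ moment μ 4 := by linarith
  calc moment μ 3 ^ 2 = moment μ 2 * (t * moment μ 3) := by rw [← e]; ring
    _ ≤ _ := by gcongr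

/-- The integral of |ξ|^n (|ξ| - T)² is nonnegative. T is left free so that the recursion can tune
it to each order. -/
theorem moment_interpolation [IsFiniteMeasure μ] {n : ℕ}
    (h : Integrable (fun ξ : Vel d => ‖ξ‖ ^ (n + 2)) μ) {T : ℝ} (hT : 0 < T) :
    2 * moment μ (n + 1) ≤ moment μ (n + 2) / T + T * moment μ n := by
  have i0 := integrable_norm_pow_of_le h (k := n) (by omega)
  have i1 := integrable_norm_pow_of_le h (k := n + 1) (by omega)
  rw [moment, moment, moment, ← integral_const_mul, ← integral_const_mul, ← integral_div,
    ← integral_add (h.div_const _) (i0.const_mul _)]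
  refine integral_mono (i1.const_mul _) ((h.div_const _).add (i0.const_mul _)) fun ξ => ?_
  have e : ‖ξ‖ ^ (n + 2) / T + T * ‖ξ‖ ^ n - 2 * ‖ξ‖ ^ (n + 1)
      = ‖ξ‖ ^ n * (‖ξ‖ - T) ^ 2 / T := by
    field_simp
    ring
  have h0 : 0 ≤ ‖ξ‖ ^ n * (‖ξ‖ - T) ^ 2 / T := by positivity
  dsimp only
  linarith

theorem moment_one_le [IsProbabilityMeasure μ]
    (h2 : Integrable (fun ξ : Vel d => ‖ξ‖ ^ 2) μ) : moment μ 1 ≤ 1 + moment μ 2 := by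
  have := moment_interpolation (n := 0) h2 one_pos
  have e : moment μ 0 = 1 := by simp [moment]
  rw [e] at this
  linarith [moment_nonneg μ 2, moment_nonneg μ 1]

theorem IsProfileLaw.moment_two (h : IsProfileLaw α μ) : moment μ 2 = (d : ℝ) / 2 := h.energy

/-- The weak identity with a homogeneous test function. -/
theorem WeakIdentity.power_bound [NeZero d] [IsProbabilityMeasure μ] (h : IsProfileLaw α μ)
    (hα : 0 ≤ α) (hα1 : α ≤ 1) {m : ℕ} (hm : 2 ≤ m)
    (him : Integrable (fun ξ : Vel d => ‖ξ‖ ^ (m + 1)) μ)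
    (hw : WeakIdentity α μ (fun ξ => ‖ξ‖ ^ m) fun ξ => (m : ℝ) * ‖ξ‖ ^ m)
    {X : Vel d → Vel d → ℝ} {S : ℝ}
    (hX : Integrable (fun p : Vel d × Vel d × Sph d => ‖p.1 - p.2.1‖ * X p.1 p.2.1)
      (collisionMeasure μ))
    (hXS : ∫ p, ‖p.1 - p.2.1‖ * X p.1 p.2.1 ∂(collisionMeasure μ) ≤ 2 * S) (hS : 0 ≤ S)
    {ρ : ℝ} (hρ0 : 0 ≤ ρ) (hρ1 : ρ ≤ 1)
    (hρ : ∀ v w, ∫ σ, (‖post v w σ‖ ^ m + ‖postStar v w σ‖ ^ m) ∂(sphereMeasure d)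
      ≤ ρ * (‖v‖ ^ m + ‖w‖ ^ m + X v w)) :
    (1 - (1 - α) * ρ) * moment μ (m + 1)
      ≤ S + α * (m / d * collisionEnergy μ * moment μ m) := by
  have hC : ∀ ξ : Vel d, |‖ξ‖ ^ m| ≤ 1 * (1 + ‖ξ‖ ^ m) := fun ξ => by
    rw [abs_of_nonneg (by positivity)]; linarith
  have hφm : Measurable fun ξ : Vel d => ‖ξ‖ ^ m := by fun_prop
  have hgain := gain_le_loss_add_cross him hφm hC hX hρ
  have iL := integrable_collision him hφm hC (Z := Prod.fst) measurable_fst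
    (fun p => by linarith [norm_nonneg p.2.1])
  have hL := integral_norm_mul_le (φ := fun ξ => ‖ξ‖ ^ m) h.integrable_id h.momentum
    (fun ξ => by positivity) iL
  have eL : ∫ ξ, ‖ξ‖ * ‖ξ‖ ^ m ∂μ = moment μ (m + 1) := by
    rw [moment]; congr 1; ext ξ; ring
  rw [eL] at hL
  set L := ∫ p, ‖p.1 - p.2.1‖ * ‖p.1‖ ^ m ∂(collisionMeasure μ) with hLdef
  set G := ∫ p, ‖p.1 - p.2.1‖ * ‖post p.1 p.2.1 p.2.2‖ ^ m ∂(collisionMeasure μ) with hG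
  have hid : L = (1 - α) * G + α * collisionRate μ * ∫ ξ, ‖ξ‖ ^ m ∂μ
      + driftCoeff α μ * ∫ ξ, (m : ℝ) * ‖ξ‖ ^ m ∂μ := hw
  rw [integral_const_mul] at hid
  change L = (1 - α) * G + α * collisionRate μ * moment μ m
      + driftCoeff α μ * (m * moment μ m) at hid
  have hm0 := moment_nonneg μ m
  have ha := collisionRate_nonneg (μ := μ)
  -- The collision rate enters with total factor 1 - m/2, which is nonpositive as m ≥ 2, and is
  -- dropped.
  have hdrift : α * collisionRate μ * moment μ m + driftCoeff α μ * (m * moment μ m)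
      ≤ α * (m / d * collisionEnergy μ * moment μ m) := by
    have h2 : (2 : ℝ) ≤ m := by exact_mod_cast hm
    have : 0 ≤ α * collisionRate μ * moment μ m * (m / 2 - 1) :=
      mul_nonneg (by positivity) (by linarith)
    rw [driftCoeff]
    have e : (α / d * collisionEnergy μ - α / 2 * collisionRate μ) * (m * moment μ m)
        = α * (m / d * collisionEnergy μ * moment μ m)
          - α * collisionRate μ * moment μ m * (m / 2) := by ring
    rw [e]
    linarith
  have hG' : G ≤ ρ * (L + S) := by
    have := mul_le_mul_of_nonneg_left hXS hρ0
    linarith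
  have h5 : (1 - α) * G ≤ (1 - α) * (ρ * (L + S)) :=
    mul_le_mul_of_nonneg_left hG' (by linarith)
  have h6 : (1 - α) * ρ ≤ 1 := by nlinarith
  have h7 : (1 - α) * ρ * S ≤ S := mul_le_of_le_one_left hS h6
  have h8 : (1 - (1 - α) * ρ) * moment μ (m + 1) ≤ (1 - (1 - α) * ρ) * L :=
    mul_le_mul_of_nonneg_left hL (by linarith)
  linarith

theorem crossSum_nonneg (μ : Measure (Vel d)) (n : ℕ) : 0 ≤ crossSum μ n :=
  Finset.sum_nonneg fun _ _ =>
    mul_nonneg (Nat.cast_nonneg _) (mul_nonneg (moment_nonneg _ _) (moment_nonneg _ _))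

/-- The moment inequality of even order. -/
theorem IsProfileLaw.even_moment_le [NeZero d] [IsProbabilityMeasure μ] (h : IsProfileLaw α μ)
    (hα : 0 < α) (hα1 : α ≤ 1) {n : ℕ} (hn : 1 ≤ n) :
    (1 - rho d (3 / 2)) * moment μ (2 * n + 3)
      ≤ crossSum μ n + (2 / d * collisionEnergy μ) * (n + 1) * moment μ (2 * n + 2) := by
  have hfin := h.integrable_pow hα hα1
  have hρ0 := rho_nonneg (d := d)
  have hρ1 := rho_three_halves_le_one (d := d)
  obtain ⟨iX, hX⟩ := integral_crossTerm_le (hfin (2 * n + 1))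
  have hpow : ∀ ξ : Vel d, ‖ξ‖ ^ (2 * n + 2) = (‖ξ‖ ^ 2) ^ (n + 1) := fun ξ => by
    rw [← pow_mul]; congr 1
  have hsm : ContDiff ℝ ∞ fun ξ : Vel d => ‖ξ‖ ^ (2 * n + 2) := by
    simp only [hpow]
    exact (contDiff_norm_sq ℝ).pow _
  have hD : ∀ ξ : Vel d, fderiv ℝ (fun ξ : Vel d => ‖ξ‖ ^ (2 * n + 2)) ξ ξ
      = ((2 * n + 2 : ℕ) : ℝ) * ‖ξ‖ ^ (2 * n + 2) := by
    intro ξ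
    simp only [hpow]
    rw [fderiv_radial (g := fun x => x ^ (n + 1)) ξ (hasDerivAt_pow (n + 1) _)]
    rw [Nat.add_sub_cancel, pow_succ _ n]
    push_cast
    ring
  have hw : WeakIdentity α μ (fun ξ => ‖ξ‖ ^ (2 * n + 2))
      fun ξ => ((2 * n + 2 : ℕ) : ℝ) * ‖ξ‖ ^ (2 * n + 2) := by
    have := WeakIdentity.of_growth h.weak (k := 2 * n + 2) (hfin _) hsm
      (C := ((2 * n + 2 : ℕ) : ℝ)) (fun ξ => ?_) (fun ξ => ?_)
    · simpa only [hD] using this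
    · rw [abs_of_nonneg (by positivity)]
      have h0 : 0 ≤ ‖ξ‖ ^ (2 * n + 2) := by positivity
      have h1 : (1 : ℝ) ≤ ((2 * n + 2 : ℕ) : ℝ) := by exact_mod_cast (by omega)
      nlinarith
    · rw [hD, abs_of_nonneg (by positivity)]
      gcongr
      linarith
  have key := WeakIdentity.power_bound h hα.le hα1 (by omega) (hfin _) hw iX hX
    (crossSum_nonneg μ n) hρ0 hρ1 (fun v w => by
      have hk : (3 / 2 : ℝ) ≤ ((n + 1 : ℕ) : ℝ) := by
        have : (1 : ℝ) ≤ n := by exact_mod_cast hn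
        push_cast
        linarith
      have := povzner hk v w
      simp only [Real.rpow_natCast] at this
      simp only [hpow]
      refine this.trans (le_of_eq ?_)
      rw [crossTerm]
      ring)
  have hm3 := moment_nonneg μ (2 * n + 3)
  have hm2 := moment_nonneg μ (2 * n + 2)
  have hb := collisionEnergy_nonneg (μ := μ)
  have e : (((2 * n + 2 : ℕ) : ℝ) / d * collisionEnergy μ * moment μ (2 * n + 2))
      = (2 / d * collisionEnergy μ) * (n + 1) * moment μ (2 * n + 2) := by
    push_cast; ring
  rw [e] at key
  have h1 : 0 ≤ (2 / d * collisionEnergy μ) * (n + 1) * moment μ (2 * n + 2) := by positivity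
  have h2 := mul_le_of_le_one_left h1 hα1
  -- Bounding 1 - α by 1 keeps a coercivity constant independent of α.
  have h3 : (1 - rho d (3 / 2)) * moment μ (2 * n + 3)
      ≤ (1 - (1 - α) * rho d (3 / 2)) * moment μ (2 * n + 2 + 1) := by
    refine mul_le_mul_of_nonneg_right ?_ hm3
    nlinarith
  linarith

/-- |ξ|³ is not smooth at the origin, so it is approached by (|ξ|² + ε)^{3/2} with ε ≤ 1, whose
growth bounds are uniform in ε. -/
theorem weakIdentity_cube [NeZero d] [IsProbabilityMeasure μ] (h : IsProfileLaw α μ)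
    (h4 : Integrable (fun ξ : Vel d => ‖ξ‖ ^ 4) μ) :
    WeakIdentity α μ (fun ξ => ‖ξ‖ ^ 3) fun ξ => ((3 : ℕ) : ℝ) * ‖ξ‖ ^ 3 := by
  set ε : ℕ → ℝ := fun n => 1 / ((n : ℝ) + 1) with hε
  have hε0 : ∀ n, 0 < ε n := fun n => by positivity
  have hε1 : ∀ n, ε n ≤ 1 := fun n => by
    rw [hε]
    exact div_le_one_of_le₀ (by linarith [Nat.cast_nonneg (α := ℝ) n]) (by positivity)
  have hlim : Tendsto ε atTop (𝓝 0) := tendsto_one_div_add_atTop_nhds_zero_nat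
  set φ : ℕ → Vel d → ℝ := fun n ξ => (‖ξ‖ ^ 2 + ε n) ^ (3 / 2 : ℝ) with hφ
  have hsm : ∀ n, ContDiff ℝ ∞ (φ n) := fun n =>
    ((contDiff_norm_sq ℝ).add contDiff_const).rpow_const_of_ne fun ξ => by
      have := hε0 n; positivity
  have hD : ∀ n ξ, fderiv ℝ (φ n) ξ ξ = 3 * ‖ξ‖ ^ 2 * (‖ξ‖ ^ 2 + ε n) ^ (1 / 2 : ℝ) := by
    intro n ξ
    have hne : ‖ξ‖ ^ 2 + ε n ≠ 0 := by have := hε0 n; positivity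
    have h1 : HasDerivAt (fun x : ℝ => (x + ε n) ^ (3 / 2 : ℝ))
        (1 * (3 / 2) * (‖ξ‖ ^ 2 + ε n) ^ ((3 / 2 : ℝ) - 1)) (‖ξ‖ ^ 2) :=
      ((hasDerivAt_id' (‖ξ‖ ^ 2)).add_const (ε n)).rpow_const (Or.inl hne)
    rw [hφ, fderiv_radial (g := fun x : ℝ => (x + ε n) ^ (3 / 2 : ℝ)) ξ h1]
    norm_num
    ring
  have hbase : ∀ n (ξ : Vel d), ‖ξ‖ ^ 2 + ε n ≤ (1 + ‖ξ‖) ^ 2 := fun n ξ => by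
    nlinarith [hε1 n, norm_nonneg ξ]
  have hpow : ∀ (t : ℝ), 0 ≤ t → ∀ j : ℕ, (t ^ 2) ^ ((j : ℝ) / 2) = t ^ j := by
    intro t ht j
    rw [← Real.rpow_natCast t 2, ← Real.rpow_mul ht, ← Real.rpow_natCast]
    congr 1
    push_cast
    ring
  have hle : ∀ n (ξ : Vel d) (j : ℕ), (‖ξ‖ ^ 2 + ε n) ^ ((j : ℝ) / 2) ≤ (1 + ‖ξ‖) ^ j := by
    intro n ξ j
    have := hε0 n
    rw [← hpow (1 + ‖ξ‖) (by positivity) j]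
    exact Real.rpow_le_rpow (by positivity) (hbase n ξ) (by positivity)
  have hcube : ∀ ξ : Vel d, (1 + ‖ξ‖) ^ 3 ≤ 4 * (1 + ‖ξ‖ ^ 3) := fun ξ => by
    have := add_pow_le zero_le_one (norm_nonneg ξ) 3
    norm_num at this
    exact this
  refine WeakIdentity.of_tendsto (k := 3) h4 (C := 12) (φn := φ)
    (Dn := fun n ξ => fderiv ℝ (φ n) ξ ξ) (fun n => (hsm n).continuous.measurable)
    (fun n => (((hsm n).continuous_fderiv (by simp)).clm_apply continuous_id).measurable)
    (fun n ξ => ?_) (fun n ξ => ?_) (fun ξ => ?_) (fun ξ => ?_)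
    (fun n => WeakIdentity.of_growth h.weak (k := 3) h4 (hsm n) (C := 12)
      (fun ξ => ?_) (fun ξ => ?_))
  case refine_1 | refine_5 =>
    have := hε0 n
    have h3 := hle n ξ 3
    rw [abs_of_nonneg (by positivity)]
    have h5 : (0 : ℝ) ≤ 1 + ‖ξ‖ ^ 3 := by positivity
    calc φ n ξ ≤ (1 + ‖ξ‖) ^ 3 := by exact_mod_cast h3
      _ ≤ _ := by linarith [hcube ξ]
  case refine_2 | refine_6 =>
    have := hε0 n
    have h1 := hle n ξ 1
    rw [hD, abs_of_nonneg (by positivity)]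
    calc _ ≤ 3 * (1 + ‖ξ‖) ^ 2 * (1 + ‖ξ‖) ^ 1 := by
          gcongr
          · linarith
          · exact_mod_cast h1
      _ ≤ _ := by linarith [hcube ξ]
  case refine_3 =>
    have := ((hlim.const_add (‖ξ‖ ^ 2)).rpow_const (p := 3 / 2) (Or.inr (by norm_num)))
    rw [add_zero] at this
    have e := hpow ‖ξ‖ (norm_nonneg _) 3
    push_cast at e
    rwa [e] at this
  case refine_4 =>
    have := (((hlim.const_add (‖ξ‖ ^ 2)).rpow_const (p := 1 / 2)
      (Or.inr (by norm_num))).const_mul (3 * ‖ξ‖ ^ 2))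
    rw [add_zero] at this
    have e := hpow ‖ξ‖ (norm_nonneg _) 1
    push_cast at e
    rw [e] at this
    simp only [hD]
    convert this using 2
    push_cast
    ring

/-- The moment inequality of order `3`. -/
theorem IsProfileLaw.third_moment_ineq [NeZero d] [IsProbabilityMeasure μ] (h : IsProfileLaw α μ)
    (hα : 0 < α) (hα1 : α ≤ 1) :
    (1 - (1 - α) * rho d (3 / 2)) * moment μ 4
      ≤ (moment μ 3 * moment μ 1 + moment μ 2 ^ 2)
        + α * (3 / d * collisionEnergy μ * moment μ 3) := by
  have hfin := h.integrable_pow hα hα1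
  have j1 := integrable_collision_pow_mul (hfin 3) (hfin 1)
  have j2 := integrable_collision_pow_mul (hfin 2) (hfin 2)
  have j3 := integrable_collision_pow_mul (hfin 1) (hfin 3)
  have j2' := j2.const_mul 2
  have j12 : Integrable (fun p : Vel d × Vel d × Sph d =>
      ‖p.1‖ ^ 3 * ‖p.2.1‖ ^ 1 + 2 * (‖p.1‖ ^ 2 * ‖p.2.1‖ ^ 2)) (collisionMeasure μ) := j1.add j2'
  have j : Integrable (fun p : Vel d × Vel d × Sph d =>
      ‖p.1‖ ^ 3 * ‖p.2.1‖ ^ 1 + 2 * (‖p.1‖ ^ 2 * ‖p.2.1‖ ^ 2) + ‖p.1‖ ^ 1 * ‖p.2.1‖ ^ 3)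
      (collisionMeasure μ) := j12.add j3
  set X : Vel d → Vel d → ℝ := fun v w => ‖v‖ ^ 2 * ‖w‖ + ‖w‖ ^ 2 * ‖v‖ with hX
  have hle : ∀ p : Vel d × Vel d × Sph d, ‖p.1 - p.2.1‖ * X p.1 p.2.1
      ≤ ‖p.1‖ ^ 3 * ‖p.2.1‖ ^ 1 + 2 * (‖p.1‖ ^ 2 * ‖p.2.1‖ ^ 2) + ‖p.1‖ ^ 1 * ‖p.2.1‖ ^ 3 := by
    intro p
    calc _ ≤ (‖p.1‖ + ‖p.2.1‖) * X p.1 p.2.1 :=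
          mul_le_mul_of_nonneg_right (norm_sub_le _ _) (by positivity)
      _ = _ := by rw [hX]; ring
  have iX : Integrable (fun p : Vel d × Vel d × Sph d => ‖p.1 - p.2.1‖ * X p.1 p.2.1)
      (collisionMeasure μ) := by
    refine j.mono' (by fun_prop) (Eventually.of_forall fun p => ?_)
    rw [Real.norm_of_nonneg (by positivity)]
    exact hle p
  have hXS : ∫ p, ‖p.1 - p.2.1‖ * X p.1 p.2.1 ∂(collisionMeasure μ)
      ≤ 2 * (moment μ 3 * moment μ 1 + moment μ 2 ^ 2) := by
    refine (integral_mono iX j hle).trans (le_of_eq ?_)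
    rw [integral_add j12 j3, integral_add j1 j2', integral_const_mul, integral_collision_pow_mul,
      integral_collision_pow_mul, integral_collision_pow_mul]
    ring
  have hm1 := moment_nonneg μ 1
  have hm3 := moment_nonneg μ 3
  have key := WeakIdentity.power_bound h hα.le hα1 (m := 3) (by omega) (hfin 4)
    (weakIdentity_cube h (hfin 4)) iX hXS (by positivity) rho_nonneg rho_three_halves_le_one
    (fun v w => by
      have hpow : ∀ (t : ℝ), 0 ≤ t → (t ^ 2) ^ (3 / 2 : ℝ) = t ^ 3 := by
        intro t ht
        rw [← Real.rpow_natCast t 2, ← Real.rpow_mul ht, ← Real.rpow_natCast]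
        congr 1
        norm_num
      have hp := povzner (le_refl (3 / 2 : ℝ)) v w
      simp only [hpow _ (norm_nonneg _)] at hp
      refine hp.trans (mul_le_mul_of_nonneg_left ?_ rho_nonneg)
      -- Bounding one factor (|v|² + |w|²)^{1/2} by |v| + |w| isolates |v|³ + |w|³ and leaves X as
      -- the mixed part.
      have hs : √(‖v‖ ^ 2 + ‖w‖ ^ 2) ≤ ‖v‖ + ‖w‖ := by
        rw [Real.sqrt_le_left (by positivity)]
        nlinarith [mul_nonneg (norm_nonneg v) (norm_nonneg w)]
      have he : (‖v‖ ^ 2 + ‖w‖ ^ 2) ^ (3 / 2 : ℝ)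
          = (‖v‖ ^ 2 + ‖w‖ ^ 2) * √(‖v‖ ^ 2 + ‖w‖ ^ 2) := by
        rw [Real.sqrt_eq_rpow, show (3 / 2 : ℝ) = 1 + 1 / 2 by norm_num,
          Real.rpow_add_of_nonneg (by positivity) (by norm_num) (by norm_num), Real.rpow_one]
      rw [he]
      calc _ ≤ (‖v‖ ^ 2 + ‖w‖ ^ 2) * (‖v‖ + ‖w‖) := by gcongr
        _ = _ := by rw [hX]; ring)
  exact_mod_cast key

/-- The uniform bound for the third moment. -/
theorem IsProfileLaw.third_moment_le [NeZero d] [IsProbabilityMeasure μ] (h : IsProfileLaw α μ)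
    (hα : 0 < α) (hα1 : α ≤ 1) {κ : ℝ} (hκ : 0 < κ)
    (hκα : κ ≤ 1 - rho d (3 / 2) - α * (3 / 2 - rho d (3 / 2))) :
    moment μ 3 ≤ 1 + (5 / 2 * (1 + d) + d ^ 2) * d / (2 * κ) := by
  have hd : (0 : ℝ) < d := by exact_mod_cast NeZero.pos d
  have hfin := h.integrable_pow hα hα1
  have hineq := h.third_moment_ineq hα hα1
  have hb := collisionEnergy_le (hfin 3)
  have hm1 := moment_one_le (hfin 2)
  have hcs := moment_three_sq_le (hfin 4) (by rw [h.moment_two]; positivity)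
  have p1 := moment_nonneg μ 1
  have p3 := moment_nonneg μ 3
  have p4 := moment_nonneg μ 4
  rw [h.moment_two] at *
  set r := rho d (3 / 2)
  have h1 : 3 / d * collisionEnergy μ * moment μ 3
      ≤ 3 / d * (moment μ 3 + d / 2 * moment μ 1) * moment μ 3 := by gcongr
  have e1 : 3 / d * (moment μ 3 + d / 2 * moment μ 1) * moment μ 3
      = 3 / d * moment μ 3 ^ 2 + 3 / 2 * (moment μ 1 * moment μ 3) := by
    field_simp
  -- Here α₀ is decided: the quadratic drift costs (3/2)α of the fourth moment, leaving 1 - r -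
  -- α(3/2 - r) ≥ κ in front of it.
  have h2 : 3 / d * moment μ 3 ^ 2 ≤ 3 / 2 * moment μ 4 := by
    calc 3 / d * moment μ 3 ^ 2 ≤ 3 / d * (d / 2 * moment μ 4) := by gcongr
      _ = _ := by field_simp
  have h3 : α * (3 / d * collisionEnergy μ * moment μ 3)
      ≤ α * (3 / 2 * moment μ 4 + 3 / 2 * (moment μ 1 * moment μ 3)) := by
    gcongr
    linarith
  have h4 : α * (3 / 2 * (moment μ 1 * moment μ 3)) ≤ 3 / 2 * (moment μ 1 * moment μ 3) :=
    mul_le_of_le_one_left (by positivity) hα1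
  have h5 : κ * moment μ 4 ≤ (1 - r - α * (3 / 2 - r)) * moment μ 4 := by gcongr
  have h6 : κ * moment μ 4 ≤ 5 / 2 * (moment μ 1 * moment μ 3) + (d / 2) ^ 2 := by
    linarith
  have h7 : moment μ 1 * moment μ 3 ≤ (1 + d) * moment μ 3 := by
    gcongr; linarith
  have h8 : κ * moment μ 3 ^ 2 ≤ d / 2 * (5 / 2 * ((1 + d) * moment μ 3) + d ^ 2) := by
    calc κ * moment μ 3 ^ 2 ≤ κ * (d / 2 * moment μ 4) := by gcongr
      _ = d / 2 * (κ * moment μ 4) := by ring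
      _ ≤ _ := by
        gcongr
        nlinarith
  have h9 : 0 ≤ (5 / 2 * (1 + d) + d ^ 2) * d / (2 * κ) := by positivity
  -- κ m_3² is bounded by an affine function of m_3; if m_3 ≥ 1 its constant term is multiplied by
  -- m_3 and one factor m_3 divided out.
  rcases le_total (moment μ 3) 1 with hc | hc
  · linarith
  · have h10 : κ * moment μ 3 * moment μ 3 ≤ d / 2 * (5 / 2 * (1 + d) + d ^ 2) * moment μ 3 := by
      have : d / 2 * (d : ℝ) ^ 2 ≤ d / 2 * d ^ 2 * moment μ 3 :=
        le_mul_of_one_le_right (by positivity) hc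
      linarith
    have h11 := le_of_mul_le_mul_right h10 (by linarith)
    have : moment μ 3 ≤ (5 / 2 * (1 + d) + d ^ 2) * d / (2 * κ) := by
      rw [le_div_iff₀ (by positivity)]
      linarith
    linarith

/-! ### Factorial growth of the moments -/

section Recursion

open scoped Nat

/-- One term of Vandermonde's identity gives C(p,k) C(p+1,k+1) ≤ C(2p+1,2k+1), and C(p+1,k+1) ≥ p+1
in this range. The gained factor p + 1 pays for the number of terms in the cross sum. -/
theorem succ_mul_choose_mul_factorial_le {p k : ℕ} (hk : k + 1 ≤ p) :
    (p + 1) * (p.choose k * ((2 * k + 1)! * (2 * (p - k))!)) ≤ (2 * p + 1)! := by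
  have hvan : p.choose k * (p + 1).choose (k + 1) ≤ (2 * p + 1).choose (2 * k + 1) := by
    have e1 : 2 * p + 1 = p + (p + 1) := by ring
    have e2 : 2 * k + 1 = k + (k + 1) := by ring
    rw [e1, e2, Nat.add_choose_eq p (p + 1) (k + (k + 1))]
    exact Finset.single_le_sum (f := fun ij : ℕ × ℕ => p.choose ij.1 * (p + 1).choose ij.2)
      (fun _ _ => Nat.zero_le _) (a := (k, k + 1)) (Finset.HasAntidiagonal.mem_antidiagonal.2 rfl)
  have hlow : p + 1 ≤ (p + 1).choose (k + 1) := by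
    have hc : k + 1 ≤ p.choose k := by
      calc k + 1 = (k + 1).choose k := by simp
        _ ≤ p.choose k := Nat.choose_le_choose k hk
    have e := Nat.add_one_mul_choose_eq p k
    refine Nat.le_of_mul_le_mul_right (c := k + 1) ?_ (Nat.succ_pos k)
    rw [← e]
    exact Nat.mul_le_mul_left _ hc
  have hfac := Nat.choose_mul_factorial_mul_factorial (show 2 * k + 1 ≤ 2 * p + 1 by omega)
  have e3 : 2 * p + 1 - (2 * k + 1) = 2 * (p - k) := by omega
  rw [e3] at hfac
  rw [← hfac]
  calc _ = p.choose k * (p + 1) * ((2 * k + 1)! * (2 * (p - k))!) := by ring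
    _ ≤ p.choose k * (p + 1).choose (k + 1) * ((2 * k + 1)! * (2 * (p - k))!) := by gcongr
    _ ≤ (2 * p + 1).choose (2 * k + 1) * ((2 * k + 1)! * (2 * (p - k))!) := by gcongr
    _ = _ := by ring

/-- Factorial growth of a sequence that satisfies the moment inequalities. -/
theorem factorial_bound {m : ℕ → ℝ} (hm0 : ∀ n, 0 ≤ m n) {R δ H e K : ℝ} (hδ : 0 < δ) (hH : 0 < H)
    (he : 0 < e) (heδ : 4 * e ≤ δ) (hK1 : 1 ≤ K) (hKR : 2 * R / e ≤ K) (hKH : H / δ ≤ K)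
    (h1 : m 1 ≤ R) (h2 : m 2 ≤ R) (h3 : m 3 ≤ R)
    (hint : ∀ n, ∀ T : ℝ, 0 < T → 2 * m (n + 1) ≤ m (n + 2) / T + T * m n)
    (hrec : ∀ n, 1 ≤ n → δ * m (2 * n + 3)
      ≤ ∑ i ∈ Finset.range n, ((n + 1).choose (i + 1) : ℝ) * (m (2 * i + 3) * m (2 * (n - i)))
        + H * (n + 1) * m (2 * n + 2)) (n : ℕ) :
    m (2 * n + 1) ≤ e / 2 * (K ^ (2 * n + 1) * (2 * n + 1)!)
      ∧ (1 ≤ n → m (2 * n) ≤ e * (K ^ (2 * n) * (2 * n)!)) := by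
  have hK0 : 0 < K := by linarith
  have hRK : R ≤ e / 2 * K := by
    rw [div_le_iff₀ he] at hKR; linarith
  have hKpow : ∀ j, K ≤ K ^ (j + 1) := fun j => le_self_pow₀ hK1 (by omega)
  have hfac1 : ∀ j : ℕ, (1 : ℝ) ≤ (j ! : ℝ) := fun j => by
    exact_mod_cast Nat.succ_le_of_lt (Nat.factorial_pos j)
  have hbase : ∀ j : ℕ, R ≤ e / 2 * (K ^ (j + 1) * (j + 1)!) := by
    intro j
    refine hRK.trans ?_
    gcongr
    calc K ≤ K ^ (j + 1) * 1 := by rw [mul_one]; exact hKpow j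
      _ ≤ _ := by gcongr; exact hfac1 _
  -- Each step yields the odd order first, from the recursion, then the even order below it, by
  -- interpolation. The even bound excludes order 0, because m_0 = 1 in the application while e is
  -- small; the cross sum only uses even orders from 2 on.
  induction n using Nat.strong_induction_on with
  | _ n ih =>
  rcases n with _ | _ | n
  · exact ⟨h1.trans (hbase 0), by omega⟩
  · refine ⟨h3.trans (hbase 2), fun _ => (h2.trans (hbase 1)).trans ?_⟩
    gcongr
    linarith
  set N := n + 1 with hN
  have hN1 : 1 ≤ N := by omega
  set P : ℝ := (N : ℝ) + 1 with hP
  have hP0 : 0 < P := by positivity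
  have odd : ∀ j ≤ N, m (2 * j + 1) ≤ e / 2 * (K ^ (2 * j + 1) * (2 * j + 1)!) := fun j hj =>
    (ih j (by omega)).1
  have even : ∀ j ≤ N, 1 ≤ j → m (2 * j) ≤ e * (K ^ (2 * j) * (2 * j)!) := fun j hj hj1 =>
    (ih j (by omega)).2 hj1
  set Q : ℝ := K ^ (2 * N + 3) * (2 * N + 3)! with hQ
  have hQ0 : 0 ≤ Q := by positivity
  have hcross : ∑ i ∈ Finset.range N,
      ((N + 1).choose (i + 1) : ℝ) * (m (2 * i + 3) * m (2 * (N - i))) ≤ e ^ 2 / 2 * Q := by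
    have hterm : ∀ i ∈ Finset.range N,
        ((N + 1).choose (i + 1) : ℝ) * (m (2 * i + 3) * m (2 * (N - i)))
        ≤ e ^ 2 / 2 * Q / P := by
      intro i hi
      have hi := Finset.mem_range.1 hi
      have o := odd (i + 1) (by omega)
      rw [show 2 * (i + 1) + 1 = 2 * i + 3 by ring] at o
      have ev := even (N - i) (by omega) (by omega)
      have hnat := succ_mul_choose_mul_factorial_le (p := N + 1) (k := i + 1) (by omega)
      rw [show 2 * (i + 1) + 1 = 2 * i + 3 by ring, show N + 1 - (i + 1) = N - i by omega,
        show 2 * (N + 1) + 1 = 2 * N + 3 by ring] at hnat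
      have hreal : (P + 1) * (((N + 1).choose (i + 1) : ℝ) * ((2 * i + 3)! * (2 * (N - i))!))
          ≤ (2 * N + 3)! := by
        rw [hP]; exact_mod_cast hnat
      have hfull : P * (((N + 1).choose (i + 1) : ℝ) * ((2 * i + 3)! * (2 * (N - i))!))
          ≤ (2 * N + 3)! := by
        refine le_trans ?_ hreal
        gcongr
        linarith
      have hexp : K ^ (2 * N + 3) = K ^ (2 * i + 3) * K ^ (2 * (N - i)) := by
        rw [← pow_add]; congr 1; omega
      rw [le_div_iff₀ hP0]
      calc _ ≤ ((N + 1).choose (i + 1) : ℝ) * ((e / 2 * (K ^ (2 * i + 3) * (2 * i + 3)!))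
            * (e * (K ^ (2 * (N - i)) * (2 * (N - i))!))) * P := by
            gcongr
            exact hm0 _
        _ = e ^ 2 / 2 * (K ^ (2 * N + 3)
            * (P * (((N + 1).choose (i + 1) : ℝ) * ((2 * i + 3)! * (2 * (N - i))!)))) := by
            rw [hexp]; ring
        _ ≤ _ := by rw [hQ]; gcongr
    refine (Finset.sum_le_sum hterm).trans ?_
    rw [Finset.sum_const, Finset.card_range, nsmul_eq_mul, mul_div_assoc', div_le_iff₀ hP0, mul_comm]
    gcongr
    linarith
  have hfac : P ^ 2 * ((2 * N + 1)! : ℝ) ≤ (2 * N + 3)! / 4 := by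
    have : ((2 * N + 3)! : ℝ) = (2 * N + 3) * ((2 * N + 2) * (2 * N + 1)!) := by
      rw [Nat.factorial_succ, Nat.factorial_succ]; push_cast; ring
    rw [this, hP]
    have h0 : (0 : ℝ) ≤ (2 * N + 1)! := by positivity
    have : ((N : ℝ) + 1) ^ 2 ≤ (2 * N + 3) * (2 * N + 2) / 4 := by
      nlinarith [Nat.cast_nonneg (α := ℝ) N]
    calc _ ≤ (2 * (N : ℝ) + 3) * (2 * N + 2) / 4 * (2 * N + 1)! := by gcongr
      _ = _ := by ring
  have hlow : H ^ 2 * P ^ 2 * m (2 * N + 1) ≤ e / 8 * δ ^ 2 * Q := by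
    have hHK : H ^ 2 ≤ δ ^ 2 * K ^ 2 := by
      rw [← mul_pow]
      refine pow_le_pow_left₀ hH.le ?_ 2
      rw [div_le_iff₀ hδ] at hKH
      linarith
    calc H ^ 2 * P ^ 2 * m (2 * N + 1)
        ≤ (δ ^ 2 * K ^ 2) * P ^ 2 * (e / 2 * (K ^ (2 * N + 1) * (2 * N + 1)!)) := by
          gcongr
          · exact hm0 _
          · exact odd N le_rfl
      _ = e / 2 * δ ^ 2 * K ^ (2 * N + 3) * (P ^ 2 * (2 * N + 1)!) := by ring
      _ ≤ e / 2 * δ ^ 2 * K ^ (2 * N + 3) * ((2 * N + 3)! / 4) := by gcongr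
      _ = _ := by rw [hQ]; ring
  have hodd : m (2 * N + 3) ≤ e / 2 * Q := by
    have hr := hrec N hN1
    -- With this T, half of δ m(2N+3) absorbs the top-order part of the drift. The rest, of size P²
    -- m(2N+1), is covered by (2N+3)! ≥ 4P² (2N+1)! and K ≥ H/δ.
    have hi := hint (2 * N + 1) (H * P / δ) (by positivity)
    rw [show 2 * N + 1 + 1 = 2 * N + 2 by ring, show 2 * N + 1 + 2 = 2 * N + 3 by ring] at hi
    have hi2 : H * P * m (2 * N + 2)
        ≤ δ / 2 * m (2 * N + 3) + H ^ 2 * P ^ 2 * m (2 * N + 1) / (2 * δ) := by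
      have := mul_le_mul_of_nonneg_left hi (by positivity : 0 ≤ H * P / 2)
      calc _ = H * P / 2 * (2 * m (2 * N + 2)) := by ring
        _ ≤ _ := this
        _ = _ := by field_simp
    have hi3 : H ^ 2 * P ^ 2 * m (2 * N + 1) / (2 * δ) ≤ e / 16 * δ * Q := by
      rw [div_le_iff₀ (by positivity)]
      linarith
    have hi4 : e ^ 2 / 2 * Q ≤ e * δ / 8 * Q :=
      mul_le_mul_of_nonneg_right (by nlinarith) hQ0
    have hi5 : 0 ≤ e * δ * Q := by positivity
    -- The cross sum contributes 1/8 and the drift 1/16; after absorbing half of the left side this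
    -- is 3/8, within the claimed 1/2.
    have hi6 : δ * m (2 * N + 3) ≤ δ * (e / 2 * Q) := by
      rw [← hP] at hr
      linarith
    exact le_of_mul_le_mul_left hi6 hδ
  refine ⟨?_, fun _ => ?_⟩
  · rw [show 2 * (n + 1 + 1) + 1 = 2 * N + 3 by omega]
    exact hodd
  · rw [show 2 * (n + 1 + 1) = 2 * N + 2 by omega]
    -- 2PK = K(2N+2) is the ratio of K^j j! at j = 2N+2 and j = 2N+1.
    have hi := hint (2 * N + 1) (2 * P * K) (by positivity)
    rw [show 2 * N + 1 + 1 = 2 * N + 2 by ring, show 2 * N + 1 + 2 = 2 * N + 3 by ring] at hi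
    set W : ℝ := K ^ (2 * N + 2) * (2 * N + 2)! with hW
    have hW0 : 0 ≤ W := by positivity
    have a1 : m (2 * N + 3) / (2 * P * K) ≤ e * W := by
      rw [div_le_iff₀ (by positivity)]
      refine hodd.trans ?_
      have : Q = K * W * (2 * N + 3) := by
        rw [hQ, hW, Nat.factorial_succ (2 * N + 2)]; push_cast; ring
      rw [this, hP]
      have : 0 ≤ e * K * W := by positivity
      have h8 : 0 ≤ e * K * W * N := by positivity
      linarith
    have a2 : 2 * P * K * m (2 * N + 1) ≤ e * W := by
      have : W = 2 * P * K * (K ^ (2 * N + 1) * (2 * N + 1)!) := by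
        rw [hW, hP, Nat.factorial_succ (2 * N + 1)]; push_cast; ring
      have o := mul_le_mul_of_nonneg_left (odd N le_rfl) (by positivity : 0 ≤ 2 * P * K)
      have : 2 * P * K * (e / 2 * (K ^ (2 * N + 1) * (2 * N + 1)!)) = e / 2 * W := by
        rw [this]; ring
      nlinarith
    linarith

end Recursion

/-! ### From factorial bounds to the exponential moment -/

/-- Factorial bounds on the moments give an exponential moment. -/
theorem exponential_moment {μ : Measure (Vel d)} [IsProbabilityMeasure μ]
    (hfin : ∀ k : ℕ, Integrable (fun ξ : Vel d => ‖ξ‖ ^ k) μ) {C K : ℝ} (hK : 0 < K)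
    (hm : ∀ n : ℕ, moment μ n ≤ C * (K ^ n * n.factorial)) :
    Integrable (fun ξ : Vel d => Real.exp (1 / (2 * K) * ‖ξ‖)) μ ∧
      -- The rate 1/(2K) makes the n-th term of the exponential series at most C 2^{-n}.
      ∫ ξ, Real.exp (1 / (2 * K) * ‖ξ‖) ∂μ ≤ C * 2 := by
  set A : ℝ := 1 / (2 * K) with hA
  have hA0 : 0 < A := by positivity
  have hC0 : 0 ≤ C := by
    have := (moment_nonneg μ 0).trans (hm 0)
    simpa using this
  set F : ℕ → Vel d → ℝ := fun n ξ => A ^ n / n.factorial * ‖ξ‖ ^ n with hF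
  have hFi : ∀ n, Integrable (F n) μ := fun n => (hfin n).const_mul _
  have hF0 : ∀ n ξ, 0 ≤ F n ξ := fun n ξ => by positivity
  have hFint : ∀ n, ∫ ξ, F n ξ ∂μ ≤ C * (1 / 2) ^ n := by
    intro n
    rw [hF, integral_const_mul]
    calc _ ≤ A ^ n / n.factorial * (C * (K ^ n * n.factorial)) := by
          gcongr; exact hm n
      _ = C * (A * K) ^ n := by rw [mul_pow]; field_simp
      _ = _ := by
        congr 2
        rw [hA]; field_simp
  have hexp : ∀ ξ : Vel d, HasSum (fun n => F n ξ) (Real.exp (A * ‖ξ‖)) := by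
    intro ξ
    have h := NormedSpace.expSeries_div_hasSum_exp (A * ‖ξ‖)
    rw [← Real.exp_eq_exp_ℝ] at h
    have hFe : (fun n => F n ξ) = fun n : ℕ => (A * ‖ξ‖) ^ n / n.factorial := by
      ext n
      rw [hF, mul_pow]
      ring
    rwa [hFe]
  have hl : ∫⁻ ξ, ENNReal.ofReal (Real.exp (A * ‖ξ‖)) ∂μ ≤ ENNReal.ofReal (C * 2) := by
    calc ∫⁻ ξ, ENNReal.ofReal (Real.exp (A * ‖ξ‖)) ∂μ
        = ∫⁻ ξ, ∑' n, ENNReal.ofReal (F n ξ) ∂μ := by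
          refine lintegral_congr fun ξ => ?_
          rw [← (hexp ξ).tsum_eq, ENNReal.ofReal_tsum_of_nonneg (fun n => hF0 n ξ)
            (hexp ξ).summable]
      _ = ∑' n, ∫⁻ ξ, ENNReal.ofReal (F n ξ) ∂μ :=
          lintegral_tsum fun n => by fun_prop
      _ ≤ ∑' n, ENNReal.ofReal (C * (1 / 2) ^ n) := by
          refine ENNReal.tsum_le_tsum fun n => ?_
          rw [← ofReal_integral_eq_lintegral_ofReal (hFi n) (Eventually.of_forall (hF0 n))]
          exact ENNReal.ofReal_le_ofReal (hFint n)
      _ = ENNReal.ofReal (C * 2) := by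
          rw [← ENNReal.ofReal_tsum_of_nonneg (fun n => by positivity)
            (summable_geometric_two.mul_left C), tsum_mul_left, tsum_geometric_two]
  have hi : Integrable (fun ξ : Vel d => Real.exp (A * ‖ξ‖)) μ := by
    refine ⟨by fun_prop, ?_⟩
    rw [hasFiniteIntegral_iff_ofReal (Eventually.of_forall fun ξ => (Real.exp_pos _).le)]
    exact hl.trans_lt ENNReal.ofReal_lt_top
  refine ⟨hi, ?_⟩
  rw [integral_eq_lintegral_of_nonneg_ae (Eventually.of_forall fun ξ => (Real.exp_pos _).le)
    hi.aestronglyMeasurable]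
  exact ENNReal.toReal_le_of_le_ofReal (by positivity) hl

/-- The exponential moment bound for profile laws, uniform in `α`. -/
theorem exists_uniform_exponential_moment [NeZero d] {κ : ℝ} (hκ : 0 < κ) :
    ∃ A M : ℝ, 0 < A ∧ 0 < M ∧ ∀ α : ℝ, 0 < α → α ≤ 1 →
      κ ≤ 1 - rho d (3 / 2) - α * (3 / 2 - rho d (3 / 2)) →
      ∀ μ : Measure (Vel d), IsProbabilityMeasure μ → IsProfileLaw α μ →
        Integrable (fun ξ : Vel d => Real.exp (A * ‖ξ‖)) μ ∧
          ∫ ξ, Real.exp (A * ‖ξ‖) ∂μ ≤ M := by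
  have hd : (0 : ℝ) < d := by exact_mod_cast NeZero.pos d
  -- B bounds the third moment, R the first three moments and H the quantity 2b/d. Then e = κ/4
  -- makes the quadratic cross sum small against κ, and K is the sum of all the lower bounds
  -- required of it. None of these depends on α.
  set B : ℝ := 1 + (5 / 2 * (1 + d) + d ^ 2) * d / (2 * κ) with hB
  have hB0 : 0 < B := by positivity
  set R : ℝ := B + (1 + d) with hR
  set H : ℝ := 2 / d * (B + d / 2 * (1 + d)) with hH
  have hH0 : 0 < H := by positivity
  set e : ℝ := κ / 4 with he
  set K : ℝ := 1 + 2 * R / e + H / κ with hK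
  have hR0 : 0 < R := by positivity
  have hK0 : 0 < K := by positivity
  refine ⟨1 / (2 * K), (1 + e) * 2, by positivity, by positivity, ?_⟩
  intro α hα hα1 hκα μ hμ h
  have hfin := h.integrable_pow hα hα1
  have h2 := h.moment_two
  have h1 := moment_one_le (hfin 2)
  rw [h2] at h1
  have h3 := h.third_moment_le hα hα1 hκ hκα
  rw [← hB] at h3
  have hen : 2 / d * collisionEnergy μ ≤ H := by
    have := collisionEnergy_le (hfin 3)
    rw [h2] at this
    rw [hH]
    gcongr
    refine this.trans ?_
    gcongr
    linarith
  have hκρ : κ ≤ 1 - rho d (3 / 2) := by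
    have : 0 ≤ α * (3 / 2 - rho d (3 / 2)) :=
      mul_nonneg hα.le (by linarith [rho_three_halves_le_one (d := d)])
    linarith
  have hfb := factorial_bound (m := moment μ) (moment_nonneg μ) (R := R) (δ := κ) (H := H) (e := e)
    (K := K) hκ hH0 (by positivity) (by linarith)
    (by have : 0 < 2 * R / e := by positivity
        have : 0 < H / κ := by positivity
        linarith)
    (by have : 0 < H / κ := by positivity
        linarith)
    (by have : 0 < 2 * R / e := by positivity
        linarith)
    (by linarith) (by rw [h2]; linarith) (by linarith)
    (fun n T hT => moment_interpolation (hfin _) hT)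
    (fun n hn => by
      have hm := h.even_moment_le hα hα1 hn
      have p3 := moment_nonneg μ (2 * n + 3)
      have p2 := moment_nonneg μ (2 * n + 2)
      calc κ * moment μ (2 * n + 3) ≤ (1 - rho d (3 / 2)) * moment μ (2 * n + 3) := by gcongr
        _ ≤ _ := hm
        _ ≤ _ := by
          rw [crossSum]
          gcongr)
  refine exponential_moment hfin hK0 fun n => ?_
  -- Order 0 lies outside the even bound; the summand 1 in C = 1 + e accounts for it.
  rcases Nat.eq_zero_or_pos n with rfl | hn
  · simp [moment]
    positivity
  have hpos : 0 ≤ K ^ n * (n.factorial : ℝ) := by positivity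
  have he0 : 0 < e := by positivity
  rcases Nat.even_or_odd' n with ⟨j, rfl | rfl⟩
  · exact ((hfb j).2 (by omega)).trans (by gcongr; linarith)
  · exact (hfb j).1.trans (by gcongr; linarith)

end

end Annihilation

/-- Integrability is asserted alongside the bound because the integral of a non-integrable function
is 0 by convention. -/
theorem proposition2p4 (d : ℕ) [NeZero d] (hd : 2 ≤ d) (αstar : ℝ)
    (hαstar : αstar < Annihilation.alphaZero d) :
    ∃ A M : ℝ, 0 < A ∧ 0 < M ∧
      ∀ α : ℝ, 0 < α → α ≤ αstar →
        ∀ ψ : Annihilation.Vel d → ℝ, Annihilation.IsProfile α ψ →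
          MeasureTheory.Integrable (fun ξ : Annihilation.Vel d => ψ ξ * Real.exp (A * ‖ξ‖)) ∧
            ∫ ξ : Annihilation.Vel d, ψ ξ * Real.exp (A * ‖ξ‖) ≤ M := by
  have hρ1 := Annihilation.rho_three_halves_le_one (d := d)
  set r := Annihilation.rho d (3 / 2) with hr
  -- The margin κ is taken at `αstar`, where it is smallest, so that the constants depend only on d
  -- and `αstar`.
  have hκ : 0 < 1 - r - αstar * (3 / 2 - r) := by
    rw [Annihilation.alphaZero, ← hr, lt_div_iff₀ (by linarith)] at hαstar
    linarith
  obtain ⟨A, M, hA, hM, h⟩ := Annihilation.exists_uniform_exponential_moment (d := d) hκ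
  refine ⟨A, M, hA, hM, fun α hα hαs ψ hψ => ?_⟩
  have hle : α * (3 / 2 - r) ≤ αstar * (3 / 2 - r) :=
    mul_le_mul_of_nonneg_right hαs (by linarith)
  have hα1 : α ≤ 1 := by nlinarith
  have hμ := hψ.isProbabilityMeasure
  obtain ⟨h1, h2⟩ := h α hα hα1 (by linarith) _ hμ hψ.isProfileLaw
  rw [Annihilation.integrable_profileMeasure hψ.measurable hψ.nonneg] at h1
  rw [Annihilation.integral_profileMeasure hψ.measurable hψ.nonneg] at h2
  exact ⟨h1, h2⟩
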